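/- For $L>0$ let $\mathbb T_L=\mathbb R/L\mathbb Z$, with the normalized measure $dx/L$: $\|f\|_{L^2(\mathbb T_L)}^2=\frac1L\int_0^L|f|^2\,dx$ and $\|f\|_{H^1(\mathbb T_L)}^2=\|f\|_{L^2}^2+\|\partial_xf\|_{L^2}^2$ for complex-valued $f$, and let $\mathbb T=\mathbb T_{2\pi}$. Consider, for $\varepsilon>0$, the regularized system $$\partial_tu_1+\partial_xu_2=0,\qquad \partial_tu_2+\partial_x(p(u_1))+i\varepsilon\,\partial_x^2u_2=0,\tag{S}$$ for complex-valued $u_1,u_2$, with one of the pressure laws $$p_1(u)=-u+|u|^2u,\qquad p_2(u)=-u+\bar u^3 .$$ Put $P(u)=\frac14|u|^4$, $\alpha=\frac12$ if $p=p_1$, and $P(u)=\frac14\operatorname{Re}u^4$, $\alpha=\frac14$ if $p=p_2$, and let $$\mathcal E(u_1,u_2)=\frac1{2\pi}\int_0^{2\pi}\Big(P(u_1)-\tfrac12|u_1|^2+\tfrac12|u_2|^2\Big)dx .$$ There are $T>0$ and $\varepsilon_0>0$ such that for $p=p_1$ and for $p=p_2$, for every $0<\varepsilon<\varepsilon_0$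 and all data $(u_1^0,u_2^0)\in H^1(\mathbb T)\times L^2(\mathbb T)$ with $$\int_{\mathbb T}u_1^0\,dx=\int_{\mathbb T}u_2^0\,dx=0,\qquad \max\big(\|u_1^0\|_{H^1},\|u_2^0\|_{L^2}\big)<\tfrac16,\qquad \mathcal E(u_1^0,u_2^0)\le0,$$ the following holds. On every circle $\mathbb T_L$ on which $x\mapsto u^0_j(x/\varepsilon^2)$ is a well-defined function for all such data, that is for every $L=2\pi\varepsilon^2N$ with an integer $N\ge1$ (in particular on $\mathbb T$ itself when $\varepsilon^{-2}$ is an integer), there is a unique $u_\varepsilon\in C^0([0,T],H^1(\mathbb T_L)\times L^2(\mathbb T_L))$ which solves (S) on $[0,T]$ in the sense of distributions and has the datum $$u_\varepsilon(0,x)=\varepsilon^{\alpha}\Big(u_1^0\big(\tfrac{x}{\varepsilon^2}\big),\,u_2^0\big(\tfrac{x}{\varepsilon^2}\big)\Big).$$ In particular $T$ and $\varepsilon_0$ do not depend on the data, and $T$ does not depend on $\varepsilon$. -/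

import Mathlib

open MeasureTheory Set Filter Topology
open scoped ContDiff ENNReal

noncomputable section

namespace VdW

instance fact_two_pi_pos : Fact (0 < 2 * Real.pi) := ⟨Real.two_pi_pos⟩

/-- The space `L²` of complex-valued maps on the circle `ℝ / Lℤ`. The circle carries the normalized
measure `dx / L`, so that `‖f‖² = (1 / L) ∫₀ᴸ |f|² dx = ∑ₖ |fₖ|²` with the Fourier coefficients
`fₖ = (1 / L) ∫₀ᴸ e^{-2π i k x / L} f(x) dx`. -/
abbrev L2 (L : ℝ) [Fact (0 < L)] : Type :=
  Lp ℂ 2 (AddCircle.haarAddCircle : Measure (AddCircle L))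

/-- Test functions on the circle `ℝ / Lℤ`: smooth `L`-periodic complex-valued functions on `ℝ`. -/
structure TestFun (L : ℝ) where
  /-- the underlying function on the line -/
  toFun : ℝ → ℂ
  smooth : ContDiff ℝ ∞ toFun
  periodic : Function.Periodic toFun L

namespace TestFun

variable {L : ℝ}

/-- The derivative of a test function. -/
def derivative (φ : TestFun L) : TestFun L where
  toFun := deriv φ.toFun
  smooth := (contDiff_infty_iff_deriv.1 φ.smooth).2
  periodic := fun x => by
    have h : (fun y => φ.toFun (y + L)) = φ.toFun := funext φ.periodic
    rw [← deriv_comp_add_const, h]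

/-- A test function, as a function on the circle. -/
def onCircle (φ : TestFun L) : AddCircle L → ℂ := φ.periodic.lift

theorem continuous_onCircle (φ : TestFun L) : Continuous φ.onCircle :=
  continuous_coinduced_dom.mpr φ.smooth.continuous

end TestFun

variable {L : ℝ} [Fact (0 < L)]

/-- The (bilinear) pairing of a function on the circle with a test function,
`(1 / L) ∫₀ᴸ f φ dx`. -/
def pairing (f : AddCircle L → ℂ) (φ : TestFun L) : ℂ :=
  ∫ x, f x * φ.onCircle x ∂AddCircle.haarAddCircle

theorem integrable_mul_onCircle (f : L2 L) (φ : TestFun L) :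
    Integrable (fun x => f x * φ.onCircle x) (AddCircle.haarAddCircle : Measure (AddCircle L)) := by
  have hf : Integrable f (AddCircle.haarAddCircle : Measure (AddCircle L)) :=
    (Lp.memLp f).integrable (by norm_num)
  obtain ⟨C, hC⟩ := (isCompact_range φ.continuous_onCircle).isBounded.exists_norm_le
  exact hf.mul_bdd (c := C) φ.continuous_onCircle.aestronglyMeasurable
    (Eventually.of_forall fun x => hC _ ⟨x, rfl⟩)

/-- `g` is the derivative of `f` in the sense of distributions on the circle. -/
def IsWeakDeriv (f g : L2 L) : Prop :=
  ∀ φ : TestFun L, pairing f φ.derivative = -pairing g φ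

theorem pairing_add (f g : L2 L) (φ : TestFun L) :
    pairing (f + g : L2 L) φ = pairing f φ + pairing g φ := by
  unfold pairing
  rw [← integral_add (integrable_mul_onCircle f φ) (integrable_mul_onCircle g φ)]
  refine integral_congr_ae ?_
  filter_upwards [Lp.coeFn_add f g] with x hx
  rw [hx, Pi.add_apply, add_mul]

theorem pairing_smul (c : ℂ) (f : L2 L) (φ : TestFun L) :
    pairing (c • f : L2 L) φ = c * pairing f φ := by
  unfold pairing
  rw [← integral_const_mul]
  refine integral_congr_ae ?_
  filter_upwards [Lp.coeFn_smul c f] with x hx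
  rw [hx, Pi.smul_apply, smul_eq_mul, mul_assoc]

variable (L) in
/-- The Sobolev space `H¹` of the circle `ℝ / Lℤ`, as the space of the pairs `(f, f')` where
`f ∈ L²` has a weak derivative `f' ∈ L²`. Its norm is `‖f‖²_{H¹} = ‖f‖²_{L²} + ‖f'‖²_{L²}`. -/
def H1 : Submodule ℂ (WithLp 2 (L2 L × L2 L)) where
  carrier := {w | IsWeakDeriv w.fst w.snd}
  add_mem' := by
    intro v w hv hw φ
    have h1 := hv φ
    have h2 := hw φ
    rw [WithLp.add_fst, WithLp.add_snd, pairing_add, pairing_add, h1, h2]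
    ring
  zero_mem' := by
    intro φ
    have h (ψ : TestFun L) : pairing (0 : L2 L) ψ = 0 := by
      have := pairing_smul 0 (0 : L2 L) ψ
      rwa [zero_smul, zero_mul] at this
    rw [WithLp.zero_fst, WithLp.zero_snd, h, h, neg_zero]
  smul_mem' := by
    intro c w hw φ
    have h1 := hw φ
    rw [WithLp.smul_fst, WithLp.smul_snd, pairing_smul, pairing_smul, h1]
    ring

/-- The map underlying an element of `H¹`. -/
def H1.fn (w : H1 L) : L2 L := w.1.fst

/-- The two pressure laws. -/
inductive PressureLaw where
  | p1
  | p2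

namespace PressureLaw

/-- `p₁(u) = -u + |u|² u` and `p₂(u) = -u + ū³`. -/
def pressure : PressureLaw → ℂ → ℂ
  | p1, u => -u + (‖u‖ : ℂ) ^ 2 * u
  | p2, u => -u + (starRingEnd ℂ u) ^ 3

/-- `P(u) = |u|⁴ / 4` for `p₁` and `P(u) = Re (u⁴) / 4` for `p₂`. -/
def potential : PressureLaw → ℂ → ℝ
  | p1, u => 1 / 4 * ‖u‖ ^ 4
  | p2, u => 1 / 4 * (u ^ 4).re

/-- The exponent `α` of the amplitude `ε ^ α` of the datum. -/
def exponent : PressureLaw → ℝ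
  | p1 => 1 / 2
  | p2 => 1 / 4

end PressureLaw

/-- The energy `∫ (P(u₁) - |u₁|² / 2 + |u₂|² / 2)`. -/
def energy (p : PressureLaw) (u₁ u₂ : L2 L) : ℝ :=
  ∫ x, (p.potential (u₁ x) - 1 / 2 * ‖u₁ x‖ ^ 2 + 1 / 2 * ‖u₂ x‖ ^ 2) ∂AddCircle.haarAddCircle

/-- `u = (u₁, u₂) ∈ C⁰([0, T], H¹ × L²)` solves
`∂ₜ u₁ + ∂ₓ u₂ = 0`, `∂ₜ u₂ + ∂ₓ (p(u₁)) + i ε ∂ₓ² u₂ = 0` on the circle `ℝ / Lℤ`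
in the sense of distributions. -/
structure IsSolution (p : PressureLaw) (ε T : ℝ) (u : ℝ → H1 L × L2 L) : Prop where
  continuousOn : ContinuousOn u (Icc 0 T)
  first : ∀ φ : TestFun L, ∀ t ∈ Icc 0 T,
    HasDerivWithinAt (fun s => pairing (H1.fn (u s).1) φ) (pairing (u t).2 φ.derivative) (Icc 0 T) t
  second : ∀ φ : TestFun L, ∀ t ∈ Icc 0 T,
    HasDerivWithinAt (fun s => pairing (u s).2 φ)
      (pairing (fun x => p.pressure (H1.fn (u t).1 x)) φ.derivative
        - Complex.I * ε * pairing (u t).2 φ.derivative.derivative) (Icc 0 T) t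

/-- `g(x) = a f(x / b)` for almost every `x ∈ ℝ`, where `f` is seen as a `2π`-periodic function
and `g` as an `L`-periodic function on the line. -/
def IsRescaling (a b : ℝ) (f : L2 (2 * Real.pi)) (g : L2 L) : Prop :=
  ∀ᵐ x : ℝ, g (x : AddCircle L) = (a : ℂ) * f ((x / b : ℝ) : AddCircle (2 * Real.pi))

end VdW

end

/-! Put `u(t, x) = ε^α v(t, x/ε²)`. On the circle of length `2π` the system becomes `∂ₜv₁ =
-ε⁻²∂v₂`, `∂ₜv₂ = ε⁻²∂(v₁ - δ c(v₁)) - iε⁻³∂²v₂`, where `c(v)` is `|v|²v` or `v̄³` and `δ = ε^{2α}`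
(`coupling`). Take as unknowns `ω = ∂v₁ + iεv₂` and `y = e^{-tA}v₂`, where `e^{tA}` is the
Schrödinger group with symbol `e^{iε⁻³n²t}`. The second derivatives cancel and, with `F = ∂(v₁ - δ
c(v₁))`, there remains `ω' = (i/ε)F`, `y' = ε⁻²e^{-tA}F`. Since `H¹` is an algebra inside the
continuous functions, `F` is a locally Lipschitz function of `∂v₁ = ω - iεv₂` in `L²`
(`norm_force_sub_le`). The system is therefore an ODE in `L² × L²`, which Picard–Lindelöf solves on
any interval once it is cut off (`exists_solution_cutoff`).

The point is a lifespan independent of `ε`, although the field has size `ε⁻²`. Two bounds close a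
bootstrap in `exists_flow`. The bound on `v₂` comes from the conserved energy `½‖v₂‖² - ∫(½|v₁|² -
δP(v₁))`, whose second part is controlled by `∂v₁` (`IsFlow.energy_eq`, `IsFlow.norm_snd_lt`). The
bound on `ω` comes from `ω' = (i/ε)ω + v₂ - i(δ/ε)∂c(v₁)`, up to the mean of `v₂`: the rotation does
not change norms (`norm_le_of_rotating`). For `p1`, `δ/ε = 1` and the rest is bounded. For `p2`,
`δ/ε = ε^{-1/2}` is large, but `v̄³` turns with frequency `-3/ε` against `1/ε`; the normal form `ω -
(δ/4)∂c` removes this nonresonant term and leaves bounded errors because `δ² = ε`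
(`IsFlow.norm_fst_le_p2`).

The flow is pulled back to the circle of length `L` along the covering `x ↦ x/ε²`; the equations
hold against test functions, which absorb the lost derivatives (`IsFlow.isSolution`). Uniqueness
repeats the cancellation one derivative lower: for the difference `(d₁, d₂)` of two solutions, `d₁ +
(i/ε)∂⁻¹d₂` and the rotated `∂⁻¹d₂` satisfy a Gronwall inequality in `L²` (`IsSolution.eqOn`). -/

noncomputable section

namespace VdW

variable {L : ℝ} [Fact (0 < L)]

/-! ### Fourier coefficients and bounded multipliers on `L²` -/

/-- The exponential `x ↦ e^{2π i n x / L}` as an element of `L²`. -/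
abbrev expL (n : ℤ) : L2 L := fourierLp 2 n

/-- The Fourier coefficient as a continuous linear functional on `L²`. -/
def coef (n : ℤ) : L2 L →L[ℂ] ℂ := innerSL ℂ (expL n)

theorem coef_eq_repr (n : ℤ) (f : L2 L) : coef n f = fourierBasis.repr f n := by
  rw [HilbertBasis.repr_apply_apply, coe_fourierBasis]; rfl

theorem coef_eq_fourierCoeff (n : ℤ) (f : L2 L) : coef n f = fourierCoeff f n := by
  rw [coef_eq_repr, fourierBasis_repr]

theorem coef_expL (m n : ℤ) : coef m (expL n : L2 L) = if m = n then 1 else 0 := by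
  have := orthonormal_iff_ite.1 (orthonormal_fourier (T := L)) m n
  exact this

theorem coef_ext {f g : L2 L} (h : ∀ n, coef n f = coef n g) : f = g := by
  apply fourierBasis.repr.injective
  ext n
  rw [← coef_eq_repr, ← coef_eq_repr, h]

/-- The exponentials span a dense subspace. Operator identities are reduced in this way to
computations on single modes. -/
theorem clm_ext {F : Type*} [AddCommGroup F] [Module ℂ F] [TopologicalSpace F]
    [T2Space F] {f g : L2 L →L[ℂ] F} (h : ∀ n, f (expL n) = g (expL n)) : f = g := by
  refine ContinuousLinearMap.ext_on (s := range (expL : ℤ → L2 L)) ?_ ?_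
  · rw [dense_iff_closure_eq, ← Submodule.topologicalClosure_coe,
      span_fourierLp_closure_eq_top (by norm_num)]
    rfl
  · rintro _ ⟨n, rfl⟩
    exact h n

theorem hasSum_expL (f : L2 L) : HasSum (fun n => coef n f • (expL n : L2 L)) f := by
  simpa only [coef_eq_repr, coe_fourierBasis] using! fourierBasis.hasSum_repr f

theorem summable_norm_coef_sq (f : L2 L) : Summable fun n => ‖coef n f‖ ^ 2 := by
  simpa only [coef_eq_fourierCoeff] using (hasSum_sq_fourierCoeff f).summable

theorem hasSum_norm_coef_sq (f : L2 L) : HasSum (fun n => ‖coef n f‖ ^ 2) (‖f‖ ^ 2) := by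
  have h := lp.hasSum_norm (p := 2) (by norm_num) (fourierBasis.repr f)
  simpa [coef_eq_repr] using h

theorem inner_eq_tsum_coef (f g : L2 L) :
    inner ℂ f g = ∑' n, starRingEnd ℂ (coef n f) * coef n g := by
  rw [← fourierBasis.tsum_inner_mul_inner f g]
  refine tsum_congr fun n => ?_
  rw [coe_fourierBasis, ← inner_conj_symm]
  rfl

theorem memLp_mult {m : ℤ → ℂ} {C : ℝ} (hm : ∀ n, ‖m n‖ ≤ C) (f : lp (fun _ : ℤ => ℂ) 2) :
    Memℓp (fun n => m n * f n) 2 := by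
  have hC : 0 ≤ C := (norm_nonneg _).trans (hm 0)
  refine memℓp_gen ?_
  have h := ((lp.memℓp f).summable (by norm_num)).mul_left (C ^ 2)
  refine h.of_nonneg_of_le (fun n => by positivity) fun n => ?_
  simp only [ENNReal.toReal_ofNat, Real.rpow_ofNat, norm_mul, mul_pow]
  gcongr
  exact hm n

/-- The bounded Fourier multiplier with symbol `m`. -/
def mult (m : ℤ → ℂ) (C : ℝ) (hm : ∀ n, ‖m n‖ ≤ C) : L2 L →L[ℂ] L2 L :=
  LinearMap.mkContinuous
    { toFun := fun f => fourierBasis.repr.symm ⟨_, memLp_mult hm (fourierBasis.repr f)⟩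
      map_add' := fun f g => by
        rw [← map_add]
        congr 1
        ext n
        simp only [map_add, lp.coeFn_add, Pi.add_apply, mul_add]
      map_smul' := fun c f => by
        rw [← map_smul]
        congr 1
        ext n
        simp only [map_smul, lp.coeFn_smul, Pi.smul_apply, smul_eq_mul, mul_left_comm,
          RingHom.id_apply] } C (fun f => by
      have hC : 0 ≤ C := (norm_nonneg _).trans (hm 0)
      simp only [LinearMap.coe_mk, AddHom.coe_mk, LinearIsometryEquiv.norm_map]
      refine lp.norm_le_of_forall_sum_le (by norm_num) (by positivity) fun s => ?_
      have h := lp.sum_rpow_le_norm_rpow (p := 2) (by norm_num) (fourierBasis.repr f) s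
      simp only [ENNReal.toReal_ofNat, Real.rpow_ofNat, norm_mul, mul_pow,
        LinearIsometryEquiv.norm_map] at h ⊢
      calc ∑ i ∈ s, ‖m i‖ ^ 2 * ‖fourierBasis.repr f i‖ ^ 2
          ≤ ∑ i ∈ s, C ^ 2 * ‖fourierBasis.repr f i‖ ^ 2 := by gcongr; exact hm _
        _ ≤ C ^ 2 * ‖f‖ ^ 2 := by rw [← Finset.mul_sum]; gcongr)

@[simp] theorem coef_mult {m : ℤ → ℂ} {C : ℝ} (hm : ∀ n, ‖m n‖ ≤ C) (n : ℤ) (f : L2 L) :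
    coef n (mult m C hm f) = m n * coef n f := by
  simp [coef_eq_repr, mult]

theorem norm_mult_le {m : ℤ → ℂ} {C : ℝ} (hm : ∀ n, ‖m n‖ ≤ C) (f : L2 L) :
    ‖mult m C hm f‖ ≤ C * ‖f‖ := by
  have hC : 0 ≤ C := (norm_nonneg _).trans (hm 0)
  exact LinearMap.mkContinuous_norm_le _ hC _ |> fun h => ContinuousLinearMap.le_of_opNorm_le _ h f

theorem mult_expL {m : ℤ → ℂ} {C : ℝ} (hm : ∀ n, ‖m n‖ ≤ C) (n : ℤ) :
    mult m C hm (expL n : L2 L) = m n • (expL n : L2 L) := by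
  refine coef_ext fun k => ?_
  rw [coef_mult, map_smul, coef_expL]
  split_ifs with h <;> simp [h]

/-- The projection onto the functions of mean zero. -/
def meanZero : L2 L →L[ℂ] L2 L :=
  mult (fun n => if n = 0 then 0 else 1) 1 (fun n => by split_ifs <;> simp)

theorem coef_meanZero (n : ℤ) (f : L2 L) :
    coef n (meanZero f) = if n = 0 then 0 else coef n f := by
  rw [meanZero, coef_mult]; split_ifs <;> simp

theorem norm_meanZero_le (f : L2 L) : ‖meanZero f‖ ≤ ‖f‖ := by
  have h := norm_mult_le (L := L) (m := fun n => if n = 0 then 0 else 1) (C := 1)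
    (fun n => by split_ifs <;> simp) f
  rwa [one_mul] at h

theorem meanZero_eq_self {f : L2 L} (h : coef 0 f = 0) : meanZero f = f := by
  refine coef_ext fun n => ?_
  rw [coef_meanZero]
  split_ifs with hn
  · rw [hn, h]
  · rfl

/-! ### Antiderivatives, the Sobolev embedding and multiplication -/

/-- The Fourier symbol of the derivative. -/
def freq (L : ℝ) (n : ℤ) : ℂ := Complex.I * (2 * Real.pi * n / L : ℝ)

theorem freq_ne_zero {n : ℤ} (hn : n ≠ 0) : freq L n ≠ 0 := by
  have hL : (0 : ℝ) < L := Fact.out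
  have : (2 * Real.pi * n / L : ℝ) ≠ 0 := by
    have := Real.pi_ne_zero
    have : (n : ℝ) ≠ 0 := by exact_mod_cast hn
    positivity
  rw [freq]
  exact mul_ne_zero Complex.I_ne_zero (by exact_mod_cast this)

theorem freq_zero (L : ℝ) : freq L 0 = 0 := by simp [freq]

theorem summable_norm_freq_inv_sq : Summable fun n : ℤ => ‖(freq L n)⁻¹‖ ^ 2 := by
  have h := (Real.summable_one_div_int_pow (p := 2)).2 (by norm_num)
  have h2 := h.mul_left ((L / (2 * Real.pi)) ^ 2)
  refine h2.congr fun n => ?_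
  rw [freq, norm_inv, norm_mul, Complex.norm_I, one_mul, Complex.norm_real, Real.norm_eq_abs,
    inv_pow, sq_abs]
  have := Real.pi_ne_zero
  have hL : L ≠ 0 := (Fact.out : (0 : ℝ) < L).ne'
  by_cases hn : (n : ℝ) = 0
  · simp [hn]
  · field_simp

/-- The constant of the embedding of `H¹` into the continuous functions. -/
def embConst (L : ℝ) : ℝ := Real.sqrt (∑' n : ℤ, ‖(freq L n)⁻¹‖ ^ 2)

/-- Cauchy–Schwarz with `∑ n⁻² < ∞`: the series of the antiderivative converges absolutely, hence
uniformly. This is the embedding of `H¹` into the continuous functions. -/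
theorem hasSum_antideriv_aux (f : L2 L) :
    Summable (fun n => ‖(freq L n)⁻¹ * coef n f‖) ∧
      ∑' n, ‖(freq L n)⁻¹ * coef n f‖ ≤ embConst L * ‖f‖ := by
  have h := Real.summable_and_inner_le_Lp_mul_Lq_tsum_of_nonneg (p := 2) (q := 2)
    (f := fun n => ‖(freq L n)⁻¹‖) (g := fun n => ‖coef n f‖)
    (by constructor <;> norm_num)
    (fun n => norm_nonneg _) (fun n => norm_nonneg _)
    (by simpa using summable_norm_freq_inv_sq (L := L)) (by simpa using summable_norm_coef_sq f)
  simp only [norm_mul]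
  refine ⟨h.1, h.2.trans_eq ?_⟩
  simp only [Real.rpow_ofNat, (hasSum_norm_coef_sq f).tsum_eq]
  rw [embConst, Real.sqrt_eq_rpow, ← Real.sqrt_eq_rpow (‖f‖ ^ 2), Real.sqrt_sq (norm_nonneg _)]

theorem summable_antideriv (f : L2 L) :
    Summable (fun n => ((freq L n)⁻¹ * coef n f) • (fourier n : C(AddCircle L, ℂ))) := by
  refine Summable.of_norm ?_
  simpa only [norm_smul, fourier_norm, mul_one] using (hasSum_antideriv_aux f).1

/-- The antiderivative of mean zero (of the mean-zero part). -/
def antideriv : L2 L →L[ℂ] C(AddCircle L, ℂ) :=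
  LinearMap.mkContinuous
    { toFun := fun f => ∑' n, ((freq L n)⁻¹ * coef n f) • (fourier n : C(AddCircle L, ℂ))
      map_add' := fun f g => by
        rw [← (summable_antideriv f).tsum_add (summable_antideriv g)]
        simp only [map_add, mul_add, add_smul]
      map_smul' := fun c f => by
        simp only [RingHom.id_apply]
        rw [← (summable_antideriv f).tsum_const_smul]
        simp only [map_smul, smul_eq_mul, smul_smul, mul_left_comm] } (embConst L) (fun f => by
      refine le_trans ?_ (hasSum_antideriv_aux f).2
      refine (norm_tsum_le_tsum_norm ?_).trans_eq ?_
      · simpa only [norm_smul, fourier_norm, mul_one] using (hasSum_antideriv_aux f).1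
      · simp only [norm_smul, fourier_norm, mul_one])

theorem norm_antideriv_le (f : L2 L) : ‖antideriv f‖ ≤ embConst L * ‖f‖ :=
  ContinuousLinearMap.le_of_opNorm_le _
    (LinearMap.mkContinuous_norm_le _ (Real.sqrt_nonneg _) _) f

theorem antideriv_expL (n : ℤ) :
    antideriv (expL n : L2 L) = (freq L n)⁻¹ • (fourier n : C(AddCircle L, ℂ)) := by
  change ∑' k, ((freq L k)⁻¹ * coef k (expL n : L2 L)) • (fourier k : C(AddCircle L, ℂ)) = _
  rw [tsum_eq_single n]
  · simp [coef_expL]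
  · intro k hk
    simp [coef_expL, hk]

/-- The inclusion of the continuous functions into `L²`. -/
def toL2 : C(AddCircle L, ℂ) →L[ℂ] L2 L := ContinuousMap.toLp 2 AddCircle.haarAddCircle ℂ

theorem toL2_ae (f : C(AddCircle L, ℂ)) : toL2 f =ᵐ[AddCircle.haarAddCircle] f :=
  ContinuousMap.coeFn_toLp _ _

theorem toL2_fourier (n : ℤ) : toL2 (fourier n : C(AddCircle L, ℂ)) = expL n := rfl

theorem toL2_injective : Function.Injective (toL2 : C(AddCircle L, ℂ) → L2 L) :=
  ContinuousMap.toLp_injective _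

/-- This includes `n = 0`: there `(freq L 0)⁻¹ = 0`, so the antiderivative forgets the mean of `f`
and has mean zero itself. -/
theorem coef_toL2_antideriv (n : ℤ) (f : L2 L) :
    coef n (toL2 (antideriv f)) = (freq L n)⁻¹ * coef n f := by
  have : (coef n).comp (toL2.comp antideriv) = (freq L n)⁻¹ • (coef n : L2 L →L[ℂ] ℂ) := by
    refine clm_ext fun k => ?_
    simp only [ContinuousLinearMap.comp_apply, antideriv_expL, map_smul, toL2_fourier, coef_expL,
      smul_eq_mul, smul_apply]
    split_ifs with h <;> simp [h]
  exact congrArg (fun g => g f) this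

/-- Multiplication by a continuous function on `L²`. -/
def mulL : C(AddCircle L, ℂ) →L[ℂ] L2 L →L[ℂ] L2 L :=
  ((ContinuousLinearMap.mul ℂ ℂ).holderL AddCircle.haarAddCircle ∞ 2 2).comp
    (ContinuousMap.toLp ∞ AddCircle.haarAddCircle ℂ)

theorem mulL_ae (f : C(AddCircle L, ℂ)) (g : L2 L) :
    mulL f g =ᵐ[AddCircle.haarAddCircle] fun x => f x * g x := by
  have h1 := ContinuousLinearMap.coeFn_holder (r := 2) (ContinuousLinearMap.mul ℂ ℂ)
    (ContinuousMap.toLp ∞ AddCircle.haarAddCircle ℂ f) g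
  have h2 := ContinuousMap.coeFn_toLp (p := ∞) (𝕜 := ℂ) AddCircle.haarAddCircle f
  filter_upwards [h1, h2] with x hx1 hx2
  refine hx1.trans ?_
  rw [hx2]; rfl

theorem norm_mulL_le (f : C(AddCircle L, ℂ)) (g : L2 L) : ‖mulL f g‖ ≤ ‖f‖ * ‖g‖ := by
  refine Lp.norm_le_mul_norm_of_ae_le_mul ?_
  filter_upwards [mulL_ae f g] with x hx
  rw [hx, norm_mul]
  gcongr
  exact f.norm_coe_le_norm x

theorem mulL_toL2 (f g : C(AddCircle L, ℂ)) : mulL f (toL2 g) = toL2 (f * g) := by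
  refine Lp.ext ?_
  filter_upwards [mulL_ae f (toL2 g), toL2_ae g, toL2_ae (f * g)] with x h1 h2 h3
  rw [h1, h2, h3]; rfl

theorem mulL_mul (f g : C(AddCircle L, ℂ)) (h : L2 L) : mulL f (mulL g h) = mulL (f * g) h := by
  refine Lp.ext ?_
  filter_upwards [mulL_ae f (mulL g h), mulL_ae g h, mulL_ae (f * g) h] with x h1 h2 h3
  rw [h1, h2, h3, ContinuousMap.mul_apply, mul_assoc]

/-! ### Truncations, the Schrödinger group and differentiation mode by mode -/

/-- The truncation of the Fourier series to the frequencies in a finite set. -/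
def trunc (s : Finset ℤ) : L2 L →L[ℂ] L2 L :=
  mult (fun n => if n ∈ s then 1 else 0) 1 (fun n => by split_ifs <;> simp)

theorem coef_trunc (s : Finset ℤ) (n : ℤ) (f : L2 L) :
    coef n (trunc s f) = if n ∈ s then coef n f else 0 := by
  rw [trunc, coef_mult]; split_ifs <;> simp

theorem norm_trunc_le (s : Finset ℤ) (f : L2 L) : ‖trunc s f‖ ≤ ‖f‖ := by
  have h := norm_mult_le (L := L) (m := fun n => if n ∈ s then 1 else 0) (C := 1)
    (fun n => by split_ifs <;> simp) f
  rwa [one_mul] at h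

theorem trunc_eq_sum (s : Finset ℤ) (f : L2 L) :
    trunc s f = ∑ n ∈ s, coef n f • (expL n : L2 L) := by
  refine coef_ext fun k => ?_
  simp [coef_trunc, coef_expL]

theorem tendsto_trunc (f : L2 L) : Tendsto (fun s => trunc s f) atTop (𝓝 f) := by
  simpa only [trunc_eq_sum] using! hasSum_expL f

theorem norm_exp_I_mul (x : ℝ) : ‖Complex.exp (Complex.I * x)‖ = 1 := by
  rw [mul_comm]; exact Complex.norm_exp_ofReal_mul_I x

/-- The Schrödinger group with symbol `e^{i μ n² t}`. -/
def group (μ t : ℝ) : L2 L →L[ℂ] L2 L :=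
  mult (fun n => Complex.exp (Complex.I * (μ * n ^ 2 * t : ℝ))) 1
    (fun n => (norm_exp_I_mul _).le)

theorem coef_group (μ t : ℝ) (n : ℤ) (f : L2 L) :
    coef n (group μ t f) = Complex.exp (Complex.I * (μ * n ^ 2 * t : ℝ)) * coef n f := coef_mult _ _ _

theorem group_neg_group (μ t : ℝ) (f : L2 L) : group μ (-t) (group μ t f) = f := by
  refine coef_ext fun n => ?_
  rw [coef_group, coef_group, ← mul_assoc, ← Complex.exp_add]
  convert one_mul _
  rw [Complex.exp_eq_one_iff]
  exact ⟨0, by push_cast; ring⟩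

theorem group_group_neg (μ t : ℝ) (f : L2 L) : group μ t (group μ (-t) f) = f := by
  simpa using group_neg_group μ (-t) f

theorem group_zero (μ : ℝ) (f : L2 L) : group μ 0 f = f := by
  refine coef_ext fun n => ?_
  rw [coef_group]; simp

theorem norm_group_le (μ t : ℝ) (f : L2 L) : ‖group μ t f‖ ≤ ‖f‖ := by
  have h := norm_mult_le (L := L)
    (m := fun n => Complex.exp (Complex.I * (μ * n ^ 2 * t : ℝ))) (C := 1)
    (fun n => (norm_exp_I_mul _).le) f
  rwa [one_mul] at h

theorem norm_group (μ t : ℝ) (f : L2 L) : ‖group μ t f‖ = ‖f‖ := by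
  refine le_antisymm (norm_group_le μ t f) ?_
  conv_lhs => rw [← group_neg_group μ t f]
  exact norm_group_le _ _ _

theorem inner_group_neg (μ t : ℝ) (f g : L2 L) :
    inner ℂ f (group μ (-t) g) = inner ℂ (group μ t f) g := by
  rw [inner_eq_tsum_coef, inner_eq_tsum_coef]
  refine tsum_congr fun n => ?_
  rw [coef_group, coef_group, map_mul, ← Complex.exp_conj]
  simp only [map_mul, Complex.conj_I, Complex.conj_ofReal]
  push_cast
  ring_nf

/-- On a truncated series the group is a finite sum of exponentials, and since it is isometric the
truncations converge uniformly in `t`. -/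
theorem continuous_group_apply (μ : ℝ) (f : L2 L) : Continuous fun t => group μ t f := by
  have h : TendstoUniformly (fun (s : Finset ℤ) t => group μ t (trunc s f))
      (fun t => group μ t f) atTop := by
    rw [Metric.tendstoUniformly_iff]
    intro ε hε
    filter_upwards [Metric.tendsto_nhds.1 (tendsto_trunc f) ε hε] with s hs t
    rw [dist_comm, dist_eq_norm, ← map_sub, norm_group, ← dist_eq_norm]
    exact hs
  refine h.continuous (Eventually.of_forall fun s => ?_).frequently
  simp only [trunc_eq_sum, map_sum, map_smul, group, mult_expL]
  fun_prop

theorem continuous_group (μ : ℝ) : Continuous fun p : ℝ × L2 L => group μ p.1 p.2 := by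
  rw [continuous_iff_continuousAt]
  rintro ⟨t, f⟩
  rw [ContinuousAt, tendsto_iff_norm_sub_tendsto_zero]
  have h1 : Tendsto (fun p : ℝ × L2 L => ‖p.2 - f‖ + ‖group μ p.1 f - group μ t f‖) (𝓝 (t, f))
      (𝓝 0) := by
    have : Continuous (fun p : ℝ × L2 L => ‖p.2 - f‖ + ‖group μ p.1 f - group μ t f‖) := by
      have := (continuous_group_apply μ f).comp (continuous_fst (X := ℝ) (Y := L2 L))
      simp only [Function.comp_def] at this
      fun_prop
    simpa using this.tendsto (t, f)
  refine squeeze_zero (fun _ => norm_nonneg _) (fun p => ?_) h1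
  calc ‖group μ p.1 p.2 - group μ t f‖
      = ‖group μ p.1 (p.2 - f) + (group μ p.1 f - group μ t f)‖ := by rw [map_sub]; congr 1; abel
    _ ≤ _ := (norm_add_le _ _).trans (by rw [norm_group])

/-- A curve whose Fourier coefficients have derivatives given by a continuous curve in `L²` is
differentiable in `L²`. -/
theorem hasDerivWithinAt_of_coef {f h : ℝ → L2 L} {T : ℝ} (hh : ContinuousOn h (Icc 0 T))
    (hc : ∀ n, ∀ t ∈ Icc 0 T,
      HasDerivWithinAt (fun s => coef n (f s)) (coef n (h t)) (Icc 0 T) t) :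
    ∀ t ∈ Icc 0 T, HasDerivWithinAt f (h t) (Icc 0 T) t := by
  intro t ht
  have hT : 0 ≤ T := ht.1.trans ht.2
  -- Extended by constants, `h` is continuous on the line, and its primitive `F` is differentiable
  -- everywhere. The coefficients of `f` and `F` have the same derivatives and initial values, so `f
  -- = F` on the interval.
  set H : ℝ → L2 L := fun s => h (projIcc 0 T hT s) with hH
  have hHc : Continuous H := by
    rw [continuousOn_iff_continuous_domRestrict] at hh
    exact hh.comp continuous_projIcc
  have hHe : ∀ s ∈ Icc 0 T, H s = h s := fun s hs => by rw [hH]; simp only [projIcc_of_mem hT hs]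
  set F : ℝ → L2 L := fun t => f 0 + ∫ s in (0 : ℝ)..t, H s
  have hF : ∀ t, HasDerivAt F (H t) t := fun t =>
    (intervalIntegral.integral_hasDerivAt_right (hHc.intervalIntegrable _ _)
      (hHc.stronglyMeasurableAtFilter _ _) hHc.continuousAt).const_add _
  have key : ∀ s ∈ Icc 0 T, f s = F s := by
    intro s hs
    refine coef_ext fun n => ?_
    have hd : ∀ r ∈ Icc 0 T,
        HasDerivWithinAt (fun r => coef n (f r) - coef n (F r)) 0 (Icc 0 T) r := by
      intro r hr
      have h1 := hc n r hr
      have h2 : HasDerivWithinAt (fun r => coef n (F r)) (coef n (H r)) (Icc 0 T) r :=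
        (((coef n).restrictScalars ℝ).hasFDerivAt.comp_hasDerivAt r (hF r)).hasDerivWithinAt
      have := h1.sub h2
      rwa [hHe r hr, sub_self] at this
    have := Convex.norm_image_sub_le_of_norm_hasDerivWithin_le (C := 0) hd (by simp)
      (convex_Icc 0 T) (left_mem_Icc.2 hT) hs
    have h0 : F 0 = f 0 := by simp [F]
    simp only [h0, sub_self, zero_mul, norm_le_zero_iff, sub_zero] at this
    exact sub_eq_zero.1 this
  have := (hF t).hasDerivWithinAt (s := Icc 0 T)
  rw [hHe t ht] at this
  exact this.congr key (key t ht)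

theorem hasDerivWithinAt_coef {f : ℝ → L2 L} {f' : L2 L} {s : Set ℝ} {t : ℝ}
    (h : HasDerivWithinAt f f' s t) (n : ℤ) :
    HasDerivWithinAt (fun r => coef n (f r)) (coef n f') s t :=
  ((coef n).restrictScalars ℝ).hasFDerivAt.comp_hasDerivWithinAt t h

theorem hasDerivAt_exp_I_mul (c t : ℝ) :
    HasDerivAt (fun s : ℝ => Complex.exp (Complex.I * (c * s : ℝ)))
      (Complex.I * c * Complex.exp (Complex.I * (c * t : ℝ))) t := by
  have h : HasDerivAt (fun s : ℝ => Complex.I * ((c * s : ℝ) : ℂ)) (Complex.I * c) t := by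
    have := ((hasDerivAt_id t).const_mul c).ofReal_comp.const_mul Complex.I
    simpa using this
  convert h.cexp using 1
  ring

/-- Stated on coefficients because the term with `n²` need not be the coefficient of an `L²`
function. -/
theorem hasDerivWithinAt_coef_group {μ : ℝ} {y : ℝ → L2 L} {y' : L2 L} {s : Set ℝ} {t : ℝ}
    (h : HasDerivWithinAt y y' s t) (n : ℤ) :
    HasDerivWithinAt (fun r => coef n (group μ r (y r)))
      (Complex.I * (μ * n ^ 2 : ℝ) * coef n (group μ t (y t)) + coef n (group μ t y')) s t := by
  simp only [coef_group]
  have := (hasDerivAt_exp_I_mul (μ * n ^ 2) t).hasDerivWithinAt (s := s) |>.mul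
    (hasDerivWithinAt_coef h n)
  refine this.congr_deriv ?_
  simp only [mul_assoc]

/-! ### Conjugation, the product rule and the trilinear form -/

/-- Complex conjugation on `L²`. -/
def conjL : L2 L →L[ℝ] L2 L :=
  ContinuousLinearMap.compLpL 2 AddCircle.haarAddCircle (Complex.conjCLE : ℂ →L[ℝ] ℂ)

theorem conjL_ae (f : L2 L) :
    conjL f =ᵐ[AddCircle.haarAddCircle] fun x => starRingEnd ℂ (f x) :=
  ContinuousLinearMap.coeFn_compLpL _ _

theorem norm_conjL (f : L2 L) : ‖conjL f‖ = ‖f‖ := by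
  refine le_antisymm (Lp.norm_le_norm_of_ae_le ?_) (Lp.norm_le_norm_of_ae_le ?_) <;>
  · filter_upwards [conjL_ae f] with x hx
    simp [hx]

theorem coef_conjL (n : ℤ) (f : L2 L) : coef n (conjL f) = starRingEnd ℂ (coef (-n) f) := by
  rw [coef_eq_fourierCoeff, coef_eq_fourierCoeff, fourierCoeff, fourierCoeff, ← integral_conj]
  refine integral_congr_ae ?_
  filter_upwards [conjL_ae f] with x hx
  rw [hx]
  simp only [smul_eq_mul, map_mul, ← fourier_neg, neg_neg]

theorem toL2_star (f : C(AddCircle L, ℂ)) : toL2 (star f) = conjL (toL2 f) := by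
  refine Lp.ext ?_
  filter_upwards [conjL_ae (toL2 f), toL2_ae f, toL2_ae (star f)] with x h1 h2 h3
  rw [h1, h2, h3]; rfl

theorem freq_neg (L : ℝ) (n : ℤ) : freq L (-n) = -freq L n := by
  simp only [freq]; push_cast; ring

theorem conj_freq (L : ℝ) (n : ℤ) : starRingEnd ℂ (freq L n) = -freq L n := by
  simp only [freq, map_mul, Complex.conj_I, Complex.conj_ofReal]; ring

theorem freq_add (L : ℝ) (m n : ℤ) : freq L (m + n) = freq L m + freq L n := by
  simp only [freq]; push_cast; ring

theorem antideriv_conjL (f : L2 L) : antideriv (conjL f) = star (antideriv f) := by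
  apply toL2_injective
  refine coef_ext fun n => ?_
  rw [coef_toL2_antideriv, toL2_star, coef_conjL, coef_conjL, coef_toL2_antideriv, map_mul,
    map_inv₀, conj_freq, freq_neg, neg_neg]

theorem coef_mulL_fourier (n k : ℤ) (g : L2 L) : coef n (mulL (fourier k) g) = coef (n - k) g := by
  rw [coef_eq_fourierCoeff, coef_eq_fourierCoeff, fourierCoeff, fourierCoeff]
  refine integral_congr_ae ?_
  filter_upwards [mulL_ae (fourier k) g] with x hx
  rw [hx, smul_eq_mul, smul_eq_mul, ← mul_assoc, ← fourier_add]
  congr 3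
  ring

/-- `g` is the derivative of the continuous function `f`, in terms of Fourier coefficients. -/
def Der (f : C(AddCircle L, ℂ)) (g : L2 L) : Prop :=
  ∀ n, coef n g = freq L n * coef n (toL2 f)

theorem der_antideriv (f : L2 L) : Der (antideriv f) (meanZero f) := by
  intro n
  rw [coef_meanZero, coef_toL2_antideriv]
  split_ifs with h
  · rw [h, freq_zero, zero_mul]
  · rw [mul_inv_cancel_left₀ (freq_ne_zero h)]

theorem mulL_toL2_comm (f g : C(AddCircle L, ℂ)) : mulL f (toL2 g) = mulL g (toL2 f) := by
  rw [mulL_toL2, mulL_toL2, mul_comm]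

/-- Both sides are continuous and linear in `a`, so `a` may be taken to be an exponential; the
product rule is then the additivity of `freq`. -/
theorem Der.antideriv_mul {f : C(AddCircle L, ℂ)} {g : L2 L} (h : Der f g) (a : L2 L) :
    Der (antideriv a * f) (mulL (antideriv a) g + mulL f (meanZero a)) := by
  intro n
  have key : (coef n).comp ((mulL.flip g).comp antideriv + (mulL f).comp meanZero) =
      freq L n • (coef n).comp ((mulL.flip (toL2 f)).comp antideriv) := by
    refine clm_ext fun k => ?_
    have h1 : meanZero (expL k : L2 L) = if k = 0 then 0 else expL k := by
      rw [meanZero, mult_expL]; split_ifs <;> simp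
    simp only [ContinuousLinearMap.comp_apply, add_apply,
      ContinuousLinearMap.flip_apply, smul_apply, antideriv_expL, map_add,
      map_smul, h1, coef_mulL_fourier, smul_eq_mul]
    by_cases hk : k = 0
    · simp [hk, freq_zero]
    · rw [if_neg hk, ← toL2_fourier, mulL_toL2_comm, coef_mulL_fourier, h (n - k)]
      have h2 := freq_ne_zero (L := L) hk
      have h3 : freq L n = freq L (n - k) + freq L k := by rw [← freq_add]; simp
      rw [h3]
      field_simp
  have := congrArg (fun l => l a) key
  simpa only [ContinuousLinearMap.comp_apply, add_apply,
    ContinuousLinearMap.flip_apply, smul_apply, mulL_toL2, smul_eq_mul] using this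

/-- The derivative of the product of three antiderivatives. -/
def trilin (a b c : L2 L) : L2 L :=
  mulL (antideriv a) (mulL (antideriv b) (meanZero c) + mulL (antideriv c) (meanZero b)) +
    mulL (antideriv b * antideriv c) (meanZero a)

theorem der_trilin (a b c : L2 L) :
    Der (antideriv a * (antideriv b * antideriv c)) (trilin a b c) :=
  ((der_antideriv c).antideriv_mul b).antideriv_mul a

theorem embConst_nonneg (L : ℝ) : 0 ≤ embConst L := Real.sqrt_nonneg _

/-- In each of the three terms the differentiated factor is measured in `L²` and the other two in
the sup norm through the embedding. -/
theorem norm_trilin_le (a b c : L2 L) :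
    ‖trilin a b c‖ ≤ 3 * embConst L ^ 2 * ‖a‖ * ‖b‖ * ‖c‖ := by
  have hC := embConst_nonneg L
  have hJ := norm_antideriv_le (L := L)
  have hM := norm_meanZero_le (L := L)
  have h2 : ∀ a b c : L2 L, ‖mulL (antideriv a) (mulL (antideriv b) (meanZero c))‖ ≤
      (embConst L * ‖a‖) * ((embConst L * ‖b‖) * ‖c‖) := fun a b c => by
    refine (norm_mulL_le _ _).trans ?_
    gcongr
    · exact hJ a
    refine (norm_mulL_le _ _).trans ?_
    gcongr
    · exact hJ b
    · exact hM c
  rw [trilin, map_add, ← mulL_mul]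
  refine (norm_add₃_le).trans ?_
  linarith [h2 a b c, h2 a c b, h2 b c a]

theorem hasDerivWithinAt_mulL {f : ℝ → C(AddCircle L, ℂ)} {g : ℝ → L2 L} {f' : C(AddCircle L, ℂ)}
    {g' : L2 L} {s : Set ℝ} {t : ℝ} (hf : HasDerivWithinAt f f' s t)
    (hg : HasDerivWithinAt g g' s t) :
    HasDerivWithinAt (fun r => mulL (f r) (g r)) (mulL (f t) g' + mulL f' (g t)) s t :=
  (mulL.bilinearRestrictScalars ℝ).hasDerivWithinAt_of_bilinear (u := f) (v := g) hf hg

theorem hasDerivWithinAt_antideriv {f : ℝ → L2 L} {f' : L2 L} {s : Set ℝ} {t : ℝ}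
    (hf : HasDerivWithinAt f f' s t) :
    HasDerivWithinAt (fun r => antideriv (f r)) (antideriv f') s t := by
  have h := (antideriv (L := L)).hasFDerivAt (x := f t) |>.restrictScalars ℝ
  exact h.comp_hasDerivWithinAt t hf

theorem hasDerivWithinAt_meanZero {f : ℝ → L2 L} {f' : L2 L} {s : Set ℝ} {t : ℝ}
    (hf : HasDerivWithinAt f f' s t) :
    HasDerivWithinAt (fun r => meanZero (f r)) (meanZero f') s t :=
  (meanZero.restrictScalars ℝ).hasFDerivAt.comp_hasDerivWithinAt t hf

theorem hasDerivWithinAt_conjL {f : ℝ → L2 L} {f' : L2 L} {s : Set ℝ} {t : ℝ}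
    (hf : HasDerivWithinAt f f' s t) :
    HasDerivWithinAt (fun r => conjL (f r)) (conjL f') s t :=
  conjL.hasFDerivAt.comp_hasDerivWithinAt t hf

theorem hasDerivWithinAt_trilin {a b c : ℝ → L2 L} {a' b' c' : L2 L} {s : Set ℝ} {t : ℝ}
    (ha : HasDerivWithinAt a a' s t) (hb : HasDerivWithinAt b b' s t)
    (hc : HasDerivWithinAt c c' s t) :
    HasDerivWithinAt (fun r => trilin (a r) (b r) (c r))
      (trilin a' (b t) (c t) + trilin (a t) b' (c t) + trilin (a t) (b t) c') s t := by
  have hJa := hasDerivWithinAt_antideriv ha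
  have hJb := hasDerivWithinAt_antideriv hb
  have hJc := hasDerivWithinAt_antideriv hc
  have h1 := hasDerivWithinAt_mulL hJb (hasDerivWithinAt_meanZero hc)
  have h2 := hasDerivWithinAt_mulL hJc (hasDerivWithinAt_meanZero hb)
  have h3 := hasDerivWithinAt_mulL hJa (h1.fun_add h2)
  have h4 := hasDerivWithinAt_mulL (hJb.fun_mul hJc) (hasDerivWithinAt_meanZero ha)
  refine (h3.fun_add h4).congr_deriv ?_
  simp only [trilin, map_add, add_apply]
  abel

theorem trilin_sub_left (a a' b c : L2 L) : trilin (a - a') b c = trilin a b c - trilin a' b c := by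
  simp only [trilin, map_sub, sub_apply]; abel

theorem trilin_sub_mid (a b b' c : L2 L) : trilin a (b - b') c = trilin a b c - trilin a b' c := by
  simp only [trilin, map_sub, sub_apply, map_add, sub_mul]; abel

theorem trilin_sub_right (a b c c' : L2 L) :
    trilin a b (c - c') = trilin a b c - trilin a b c' := by
  simp only [trilin, map_sub, sub_apply, map_add, mul_sub]; abel

theorem trilin_smul (x y z : ℂ) (a b c : L2 L) :
    trilin (x • a) (y • b) (z • c) = (x * (y * z)) • trilin a b c := by
  simp only [trilin, map_smul, smul_apply, smul_add, map_add, smul_smul, smul_mul_smul_comm]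
  ring_nf

theorem conjL_smul (x : ℂ) (a : L2 L) : conjL (x • a) = starRingEnd ℂ x • conjL a := by
  refine coef_ext fun n => ?_
  simp [coef_conjL]

/-! ### The cubic force and its Lipschitz bounds -/

/-- The factor `u` of `|u|² u = ū u u` becomes `ū` for the second law. -/
def twist : PressureLaw → L2 L →L[ℝ] L2 L
  | .p1 => ContinuousLinearMap.id ℝ _
  | .p2 => conjL

/-- The action of `twist` on continuous functions. -/
def twistC : PressureLaw → C(AddCircle L, ℂ) → C(AddCircle L, ℂ)
  | .p1, f => f
  | .p2, f => star f

theorem norm_twist (p : PressureLaw) (f : L2 L) : ‖twist p f‖ = ‖f‖ := by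
  cases p
  · rfl
  · exact norm_conjL f

theorem antideriv_twist (p : PressureLaw) (f : L2 L) :
    antideriv (twist p f) = twistC p (antideriv f) := by
  cases p
  · rfl
  · exact antideriv_conjL f

/-- The cubic part `|f|² f` or `f̄³` of the pressure. -/
def cubic (p : PressureLaw) (f : C(AddCircle L, ℂ)) : C(AddCircle L, ℂ) :=
  star f * (twistC p f * twistC p f)

theorem pressure_eq (p : PressureLaw) (f : C(AddCircle L, ℂ)) (x : AddCircle L) :
    p.pressure (f x) = -f x + cubic p f x := by
  cases p
  · simp only [PressureLaw.pressure, cubic, twistC, ContinuousMap.mul_apply,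
      ContinuousMap.star_apply, RCLike.star_def, ← Complex.conj_mul']
    ring
  · simp only [PressureLaw.pressure, cubic, twistC, ContinuousMap.mul_apply,
      ContinuousMap.star_apply, RCLike.star_def]
    ring

/-- The derivative of the cubic part of the pressure. -/
def cubicDeriv (p : PressureLaw) (a : L2 L) : L2 L := trilin (conjL a) (twist p a) (twist p a)

theorem der_cubic (p : PressureLaw) (a : L2 L) : Der (cubic p (antideriv a)) (cubicDeriv p a) := by
  rw [cubic, ← antideriv_conjL, ← antideriv_twist]
  exact der_trilin _ _ _

theorem norm_cubicDeriv_le (p : PressureLaw) (a : L2 L) :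
    ‖cubicDeriv p a‖ ≤ 3 * embConst L ^ 2 * ‖a‖ ^ 3 := by
  refine (norm_trilin_le _ _ _).trans_eq ?_
  rw [norm_conjL, norm_twist]; ring

theorem norm_cubicDeriv_sub_le (p : PressureLaw) (a b : L2 L) {r : ℝ} (ha : ‖a‖ ≤ r)
    (hb : ‖b‖ ≤ r) :
    ‖cubicDeriv p a - cubicDeriv p b‖ ≤ 9 * embConst L ^ 2 * r ^ 2 * ‖a - b‖ := by
  have hC := embConst_nonneg L
  have hr : 0 ≤ r := (norm_nonneg _).trans ha
  have h : cubicDeriv p a - cubicDeriv p b =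
      trilin (conjL (a - b)) (twist p a) (twist p a) + trilin (conjL b) (twist p (a - b)) (twist p a)
      + trilin (conjL b) (twist p b) (twist p (a - b)) := by
    simp only [cubicDeriv, map_sub, trilin_sub_left, trilin_sub_mid, trilin_sub_right]; abel
  rw [h]
  refine norm_add₃_le.trans ?_
  have h1 := norm_trilin_le (conjL (a - b)) (twist p a) (twist p a)
  have h2 := norm_trilin_le (conjL b) (twist p (a - b)) (twist p a)
  have h3 := norm_trilin_le (conjL b) (twist p b) (twist p (a - b))
  simp only [norm_conjL, norm_twist] at h1 h2 h3
  have e1 : 3 * embConst L ^ 2 * ‖a - b‖ * ‖a‖ * ‖a‖ ≤ 3 * embConst L ^ 2 * ‖a - b‖ * r * r := by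
    gcongr
  have e2 : 3 * embConst L ^ 2 * ‖b‖ * ‖a - b‖ * ‖a‖ ≤ 3 * embConst L ^ 2 * r * ‖a - b‖ * r := by
    gcongr
  have e3 : 3 * embConst L ^ 2 * ‖b‖ * ‖b‖ * ‖a - b‖ ≤ 3 * embConst L ^ 2 * r * r * ‖a - b‖ := by
    gcongr
  linarith

/-- `-∂ₓ (-v + δ c(v))` as a function of `∂ₓ v`. -/
def force (p : PressureLaw) (δ : ℝ) (a : L2 L) : L2 L := meanZero a - (δ : ℂ) • cubicDeriv p a

theorem der_force (p : PressureLaw) (δ : ℝ) (a : L2 L) :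
    Der (antideriv a - (δ : ℂ) • cubic p (antideriv a)) (force p δ a) := by
  intro n
  rw [force, map_sub, map_smul, der_antideriv a n, der_cubic p a n, map_sub, map_sub, map_smul,
    map_smul, smul_eq_mul, smul_eq_mul]
  ring

theorem coef_zero_force (p : PressureLaw) (δ : ℝ) (a : L2 L) : coef 0 (force p δ a) = 0 := by
  rw [der_force p δ a 0, freq_zero, zero_mul]

theorem norm_force_le (p : PressureLaw) {δ : ℝ} (hδ : 0 ≤ δ) (a : L2 L) :
    ‖force p δ a‖ ≤ ‖a‖ + δ * (3 * embConst L ^ 2 * ‖a‖ ^ 3) := by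
  refine (norm_sub_le _ _).trans ?_
  rw [norm_smul, Complex.norm_real, Real.norm_of_nonneg hδ]
  gcongr
  · exact norm_meanZero_le a
  · exact norm_cubicDeriv_le p a

/-- As a function of `∂ₓ v` the force loses no derivative: this makes the system for `(ω, y)` an
ODE. -/
theorem norm_force_sub_le (p : PressureLaw) {δ : ℝ} (hδ : 0 ≤ δ) (a b : L2 L) {r : ℝ}
    (ha : ‖a‖ ≤ r) (hb : ‖b‖ ≤ r) :
    ‖force p δ a - force p δ b‖ ≤ (1 + δ * (9 * embConst L ^ 2 * r ^ 2)) * ‖a - b‖ := by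
  have h : force p δ a - force p δ b =
      meanZero (a - b) - (δ : ℂ) • (cubicDeriv p a - cubicDeriv p b) := by
    simp only [force, map_sub, smul_sub]; abel
  rw [h, add_mul, one_mul, mul_assoc δ]
  refine (norm_sub_le _ _).trans ?_
  rw [norm_smul, Complex.norm_real, Real.norm_of_nonneg hδ]
  gcongr
  · exact norm_meanZero_le _
  · exact norm_cubicDeriv_sub_le p a b ha hb

theorem continuous_force (p : PressureLaw) {δ : ℝ} (hδ : 0 ≤ δ) :
    Continuous (force p δ : L2 L → L2 L) := by
  have h : LocallyLipschitz (force p δ : L2 L → L2 L) := by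
    intro a
    refine ⟨⟨1 + δ * (9 * embConst L ^ 2 * (‖a‖ + 1) ^ 2), by positivity⟩, Metric.ball a 1,
      Metric.ball_mem_nhds a one_pos, LipschitzOnWith.of_dist_le_mul fun x hx y hy => ?_⟩
    have hb : ∀ z ∈ Metric.ball a 1, ‖z‖ ≤ ‖a‖ + 1 := fun z hz => by
      have := norm_le_norm_add_norm_sub' z a
      rw [Metric.mem_ball, dist_eq_norm] at hz
      linarith
    rw [dist_eq_norm, dist_eq_norm]
    exact norm_force_sub_le p hδ x y (hb x hx) (hb y hy)
  exact h.continuous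

/-! ### Test functions and weak derivatives on the Fourier side -/

namespace TestFun

/-- A test function as a continuous function on the circle. -/
def toC (φ : TestFun L) : C(AddCircle L, ℂ) := ⟨φ.onCircle, φ.continuous_onCircle⟩

end TestFun

/-- The pairing with a test function as a continuous linear functional on `L²`. -/
def pairingL (φ : TestFun L) : L2 L →L[ℂ] ℂ := innerSL ℂ (toL2 (star φ.toC))

theorem pairingL_apply (φ : TestFun L) (f : L2 L) : pairingL φ f = pairing f φ := by
  rw [pairingL, innerSL_apply_apply, L2.inner_def, pairing]
  refine integral_congr_ae ?_
  filter_upwards [toL2_ae (star φ.toC)] with x hx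
  rw [hx]
  simp [TestFun.toC]

theorem pairingL_expL (φ : TestFun L) (n : ℤ) :
    pairingL φ (expL n) = (1 / L : ℝ) • ∫ x in (0 : ℝ)..0 + L,
      fourier n (x : AddCircle L) * φ.toFun x := by
  rw [pairingL_apply]
  have : pairing (expL n : L2 L) φ = fourierCoeff φ.onCircle (-n) := by
    rw [pairing, fourierCoeff]
    refine integral_congr_ae ?_
    filter_upwards [coeFn_fourierLp 2 n] with x hx
    rw [hx, neg_neg, smul_eq_mul]
  rw [this, fourierCoeff_eq_intervalIntegral _ _ 0, neg_neg]
  rfl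

/-- Integration by parts over one period; the boundary terms cancel by periodicity. -/
theorem pairingL_derivative_expL (φ : TestFun L) (n : ℤ) :
    pairingL φ.derivative (expL n) = -(freq L n * pairingL φ (expL n)) := by
  have hL : (L : ℂ) ≠ 0 := by exact_mod_cast (Fact.out : (0 : ℝ) < L).ne'
  rw [pairingL_expL, pairingL_expL]
  have hd : ∀ x, HasDerivAt φ.toFun (φ.derivative.toFun x) x := fun x =>
    ((φ.smooth.differentiable (by norm_num)) x).hasDerivAt
  have hc : Continuous fun x : ℝ => (fourier n (x : AddCircle L) : ℂ) := by
    exact (fourier n).continuous.comp (AddCircle.continuous_mk' L)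
  have h := intervalIntegral.integral_mul_deriv_eq_deriv_mul (a := 0) (b := 0 + L)
    (fun x _ => hasDerivAt_fourier L n x) (fun x _ => hd x)
    ((continuous_const.mul hc).intervalIntegrable _ _)
    (φ.derivative.smooth.continuous.intervalIntegrable _ _)
  have hper : φ.toFun (0 + L) = φ.toFun 0 := φ.periodic 0
  have hper2 : ((0 + L : ℝ) : AddCircle L) = (0 : ℝ) := by simp
  rw [h, hper, hper2, sub_self, zero_sub]
  simp only [mul_assoc]
  rw [intervalIntegral.integral_const_mul]
  simp only [freq, Complex.real_smul]
  push_cast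
  ring

/-- The exponentials as test functions. -/
def expTest (L : ℝ) (n : ℤ) : TestFun L where
  toFun x := fourier n (x : AddCircle L)
  smooth := by
    simp only [fourier_coe_apply]
    have := Complex.ofRealCLM.contDiff (n := ∞)
    exact (((contDiff_const.mul this).div_const _)).cexp
  periodic x := by simp

theorem expTest_toC (n : ℤ) : (expTest L n).toC = fourier n := by
  ext x
  induction x using QuotientAddGroup.induction_on with
  | H x => rfl

theorem pairingL_expTest (n : ℤ) (f : L2 L) : pairingL (expTest L n) f = coef (-n) f := by
  rw [pairingL, expTest_toC]
  congr 2
  rw [← toL2_fourier]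
  congr 1
  ext x
  simp

theorem expTest_derivative_toC (n : ℤ) :
    (expTest L n).derivative.toC = freq L n • fourier n := by
  ext x
  induction x using QuotientAddGroup.induction_on with
  | H x =>
    refine (hasDerivAt_fourier L n x).deriv.trans ?_
    simp only [freq, ContinuousMap.smul_apply, smul_eq_mul]
    push_cast
    congr 1
    ring

theorem pairing_expTest (n : ℤ) (f : AddCircle L → ℂ) :
    pairing f (expTest L n) = fourierCoeff f (-n) := by
  rw [pairing, fourierCoeff]
  congr 1
  ext x
  rw [neg_neg, smul_eq_mul, mul_comm, ← expTest_toC]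
  rfl

theorem pairing_expTest_derivative (n : ℤ) (f : AddCircle L → ℂ) :
    pairing f (expTest L n).derivative = freq L n * fourierCoeff f (-n) := by
  rw [pairing, fourierCoeff, ← integral_const_mul]
  congr 1
  ext x
  have : (expTest L n).derivative.onCircle x = (freq L n • fourier n : C(AddCircle L, ℂ)) x := by
    rw [← expTest_derivative_toC]; rfl
  rw [this, neg_neg, smul_eq_mul, ContinuousMap.smul_apply, smul_eq_mul]
  ring

theorem pairing_expTest_derivative_derivative (n : ℤ) (f : L2 L) :
    pairing f (expTest L n).derivative.derivative = freq L n ^ 2 * coef (-n) f := by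
  have h : (pairingL (expTest L n).derivative.derivative : L2 L →L[ℂ] ℂ) =
      (freq L n ^ 2) • coef (-n) := by
    refine clm_ext fun k => ?_
    rw [pairingL_derivative_expL, pairingL_derivative_expL, pairingL_expTest,
      smul_apply, coef_expL]
    split_ifs with h
    · rw [← h, freq_neg]; simp [sq]
    · simp
  rw [← pairingL_apply, h]
  rfl

theorem IsWeakDeriv.coef_eq {f g : L2 L} (h : IsWeakDeriv f g) (n : ℤ) :
    coef n g = freq L n * coef n f := by
  have := h (expTest L (-n))
  rw [pairing_expTest_derivative, pairing_expTest, neg_neg, freq_neg, ← coef_eq_fourierCoeff,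
    ← coef_eq_fourierCoeff] at this
  linear_combination this

/-! ### The cut-off differential equation for `(ω, y)` -/

/-- The radial retraction onto the ball of radius `r`. -/
def retract {E : Type*} [NormedAddCommGroup E] [NormedSpace ℝ E] (r : ℝ) (x : E) : E :=
  (r / max r ‖x‖) • x

section retract

variable {E : Type*} [NormedAddCommGroup E] [NormedSpace ℝ E] {r : ℝ}

theorem retract_of_norm_le (hr : 0 < r) {x : E} (hx : ‖x‖ ≤ r) : retract r x = x := by
  rw [retract, max_eq_left hx, div_self hr.ne', one_smul]

theorem norm_retract_le (hr : 0 < r) (x : E) : ‖retract r x‖ ≤ r := by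
  have hm : 0 < max r ‖x‖ := lt_max_of_lt_left hr
  rw [retract, norm_smul, Real.norm_of_nonneg (by positivity), div_mul_eq_mul_div, div_le_iff₀ hm]
  gcongr
  exact le_max_right _ _

theorem norm_retract_sub_le (hr : 0 < r) (x y : E) :
    ‖retract r x - retract r y‖ ≤ 2 * ‖x - y‖ := by
  set a := max r ‖x‖ with ha
  set b := max r ‖y‖ with hb
  have ha0 : 0 < a := lt_max_of_lt_left hr
  have hb0 : 0 < b := lt_max_of_lt_left hr
  have hab : |b - a| ≤ ‖x - y‖ := by
    refine (abs_max_sub_max_le_max r ‖y‖ r ‖x‖).trans ?_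
    rw [sub_self, abs_zero, max_eq_right (abs_nonneg _), norm_sub_rev x y]
    exact abs_norm_sub_norm_le y x
  -- First the argument moves with the factor fixed, then the factor moves with `y` fixed. Each
  -- change costs at most `‖x - y‖`, whence the constant `2`.
  have h : retract r x - retract r y = (r / a) • (x - y) + ((r / a) * ((b - a) / b)) • y := by
    have : (r / a) * ((b - a) / b) = r / a - r / b := by field_simp
    rw [this, retract, retract, ← ha, ← hb, sub_smul, smul_sub]
    abel
  have hra : r / a ≤ 1 := (div_le_one ha0).2 (le_max_left _ _)
  have hra0 : 0 ≤ r / a := by positivity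
  rw [h, two_mul]
  refine (norm_add_le _ _).trans (add_le_add ?_ ?_)
  · rw [norm_smul, Real.norm_of_nonneg hra0]
    exact mul_le_of_le_one_left (norm_nonneg _) hra
  · rw [norm_smul, norm_mul, Real.norm_of_nonneg hra0, norm_div, Real.norm_eq_abs (b - a),
      Real.norm_of_nonneg hb0.le]
    have h1 : ‖y‖ ≤ b := le_max_right _ _
    calc r / a * (|b - a| / b) * ‖y‖ ≤ 1 * (|b - a| / b) * b := by gcongr
      _ = |b - a| := by field_simp
      _ ≤ _ := hab

end retract

/-- `∂ₓ v₁`, in terms of `ω = ∂ₓ v₁ + i ε v₂` and of `y = e^{-t A} v₂`. -/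
def etaOf (ε μ t : ℝ) (x : L2 L × L2 L) : L2 L := x.1 - (Complex.I * ε) • group μ t x.2

/-- The vector field of the equation for `(ω, y)`, as a function of the force. -/
def fieldOf (ε μ t : ℝ) (f : L2 L) : L2 L × L2 L :=
  ((Complex.I / ε) • f, ((1 / ε ^ 2 : ℝ) : ℂ) • group μ (-t) f)

theorem fieldOf_sub (ε μ t : ℝ) (f g : L2 L) :
    fieldOf ε μ t f - fieldOf ε μ t g = fieldOf ε μ t (f - g) := by
  simp [fieldOf, smul_sub]

theorem norm_fieldOf_le {ε : ℝ} (hε : 0 < ε) (μ t : ℝ) (f : L2 L) :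
    ‖fieldOf ε μ t f‖ ≤ (1 / ε + 1 / ε ^ 2) * ‖f‖ := by
  have h1 : 0 ≤ 1 / ε * ‖f‖ := by positivity
  have h2 : 0 ≤ 1 / ε ^ 2 * ‖f‖ := by positivity
  rw [fieldOf, Prod.norm_def, norm_smul, norm_smul, norm_group, Complex.norm_real, norm_div,
    Complex.norm_I, Complex.norm_real, Real.norm_of_nonneg hε.le,
    Real.norm_of_nonneg (by positivity), add_mul]
  exact max_le (by linarith) (by linarith)

theorem etaOf_sub (ε μ t : ℝ) (x y : L2 L × L2 L) :
    etaOf ε μ t x - etaOf ε μ t y = etaOf ε μ t (x - y) := by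
  simp only [etaOf, Prod.fst_sub, Prod.snd_sub, map_sub, smul_sub]; abel

theorem norm_etaOf_le {ε : ℝ} (hε : 0 < ε) (μ t : ℝ) (x : L2 L × L2 L) :
    ‖etaOf ε μ t x‖ ≤ ‖x.1‖ + ε * ‖x.2‖ := by
  refine (norm_sub_le _ _).trans_eq ?_
  rw [norm_smul, norm_group, norm_mul, Complex.norm_I, Complex.norm_real,
    Real.norm_of_nonneg hε.le, one_mul]

theorem continuous_group_comp {X : Type*} [TopologicalSpace X] (μ : ℝ) {f : X → ℝ}
    {g : X → L2 L} (hf : Continuous f) (hg : Continuous g) :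
    Continuous fun x => group μ (f x) (g x) := by
  have h1 : Continuous fun x => (f x, g x) := hf.prodMk hg
  have h2 := continuous_group (L := L) μ
  have h3 := h2.comp h1
  exact h3

theorem continuousOn_group_comp {X : Type*} [TopologicalSpace X] (μ : ℝ) {f : X → ℝ}
    {g : X → L2 L} {s : Set X} (hf : ContinuousOn f s) (hg : ContinuousOn g s) :
    ContinuousOn (fun x => group μ (f x) (g x)) s := by
  have h1 : ContinuousOn (fun x => (f x, g x)) s := hf.prodMk hg
  have h2 := continuous_group (L := L) μ
  have h3 := h2.comp_continuousOn h1
  exact h3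

theorem continuous_const_csmul {X : Type*} [TopologicalSpace X] (c : ℂ)
    {g : X → L2 L} (hg : Continuous g) : Continuous fun x => c • g x := by
  have h := continuous_const_smul (T := L2 L) c
  have h1 := h.comp hg
  exact h1

theorem continuousOn_etaOf (ε μ : ℝ) {x : ℝ → L2 L × L2 L} {s : Set ℝ} (hx : ContinuousOn x s) :
    ContinuousOn (fun t => etaOf ε μ t (x t)) s := by
  have h1 : ContinuousOn (fun t => (x t).1) s := continuous_fst.comp_continuousOn hx
  have h2 : ContinuousOn (fun t => (x t).2) s := continuous_snd.comp_continuousOn hx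
  have h3 := continuousOn_group_comp μ continuousOn_id h2
  have h4 := (continuous_const_csmul (L := L) (Complex.I * ε) continuous_id).comp_continuousOn h3
  have h5 := h1.sub h4
  exact h5

/-- The cut-off at radius `r` makes the field bounded by `M` and Lipschitz with constant `K` on the
whole space. A solution stays in the ball of radius `M * T`, so `T` is arbitrary. -/
theorem exists_solution_cutoff (p : PressureLaw) {ε δ : ℝ} (hε : 0 < ε) (hδ : 0 ≤ δ) (μ : ℝ)
    {r : ℝ} (hr : 0 < r) {T : ℝ} (hT : 0 ≤ T) (x₀ : L2 L × L2 L) :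
    ∃ x : ℝ → L2 L × L2 L, x 0 = x₀ ∧ ∀ t ∈ Icc 0 T, HasDerivWithinAt x
      (fieldOf ε μ t (force p δ (retract r (etaOf ε μ t (x t))))) (Icc 0 T) t := by
  set M : ℝ := (1 / ε + 1 / ε ^ 2) * (r + δ * (3 * embConst L ^ 2 * r ^ 3)) with hM
  have hC := embConst_nonneg L
  have hM0 : 0 ≤ M := by positivity
  set K : ℝ := (1 / ε + 1 / ε ^ 2) * ((1 + δ * (9 * embConst L ^ 2 * r ^ 2)) * (2 * (1 + ε)))
    with hK
  have hK0 : 0 ≤ K := by positivity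
  have key : IsPicardLindelof
      (fun t x => fieldOf ε μ t (force p δ (retract r (etaOf ε μ t x))))
      (tmin := 0) (tmax := T) ⟨0, left_mem_Icc.2 hT⟩ x₀ (M * T).toNNReal 0 M.toNNReal
      K.toNNReal := by
    constructor
    · intro t _
      refine LipschitzOnWith.of_dist_le_mul fun x _ y _ => ?_
      rw [dist_eq_norm, dist_eq_norm, fieldOf_sub]
      refine (norm_fieldOf_le hε _ _ _).trans ?_
      rw [Real.coe_toNNReal _ hK0, hK, mul_assoc]
      refine mul_le_mul_of_nonneg_left ?_ (by positivity)
      refine (norm_force_sub_le p hδ _ _ (norm_retract_le hr (etaOf ε μ t x))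
        (norm_retract_le hr (etaOf ε μ t y))).trans ?_
      rw [mul_assoc (1 + δ * (9 * embConst L ^ 2 * r ^ 2))]
      refine mul_le_mul_of_nonneg_left ?_ (by positivity)
      refine (norm_retract_sub_le hr (etaOf ε μ t x) (etaOf ε μ t y)).trans ?_
      rw [mul_assoc (2 : ℝ)]
      refine mul_le_mul_of_nonneg_left ?_ (zero_le_two (α := ℝ))
      rw [etaOf_sub]
      refine (norm_etaOf_le hε _ _ _).trans ?_
      rw [add_mul, one_mul]
      exact add_le_add (norm_fst_le (x - y)) (mul_le_mul_of_nonneg_left (norm_snd_le (x - y)) hε.le)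
    · intro x _
      have h1 : Continuous fun t : ℝ => etaOf ε μ t x :=
        continuousOn_univ.1 (continuousOn_etaOf ε μ continuousOn_const)
      have h2 : Continuous (retract r : L2 L → L2 L) := by
        refine LipschitzWith.continuous (K := 2) (LipschitzWith.of_dist_le_mul fun x y => ?_)
        rw [dist_eq_norm, dist_eq_norm]
        exact norm_retract_sub_le hr x y
      have h3 := (continuous_force (L := L) p hδ).comp (h2.comp h1)
      have h4 := continuous_group_comp μ continuous_neg h3
      have h5 := (continuous_const_csmul (Complex.I / ε) h3).prodMk
        (continuous_const_csmul (((1 / ε ^ 2 : ℝ) : ℂ)) h4)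
      exact h5.continuousOn
    · intro t _ x _
      refine (norm_fieldOf_le hε _ _ _).trans ?_
      rw [Real.coe_toNNReal _ hM0, hM]
      gcongr
      have h := norm_retract_le hr (etaOf ε μ t x)
      refine (norm_force_le p hδ _).trans ?_
      gcongr
    · simp only [sub_zero, sub_self, max_eq_left hT, Real.coe_toNNReal _ hM0, NNReal.coe_zero,
        Real.coe_toNNReal _ (mul_nonneg hM0 hT), le_refl]
  exact key.exists_eq_forall_mem_Icc_hasDerivWithinAt₀

/-! ### The potential part of the energy -/

/-- The mean of a continuous function. -/
def mean : C(AddCircle L, ℂ) →L[ℂ] ℂ := (coef 0).comp toL2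

theorem mean_eq_integral (f : C(AddCircle L, ℂ)) :
    mean f = ∫ x, f x ∂AddCircle.haarAddCircle := by
  rw [mean, ContinuousLinearMap.comp_apply, coef_eq_fourierCoeff, fourierCoeff]
  refine integral_congr_ae ?_
  filter_upwards [toL2_ae f] with x hx
  simp [hx]

theorem norm_mean_le (f : C(AddCircle L, ℂ)) : ‖mean f‖ ≤ ‖f‖ := by
  rw [mean_eq_integral]
  refine (norm_integral_le_of_norm_le_const (Eventually.of_forall f.norm_coe_le_norm)).trans_eq ?_
  simp

theorem re_mean_star (f : C(AddCircle L, ℂ)) : (mean (star f)).re = (mean f).re := by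
  rw [mean_eq_integral, mean_eq_integral]
  have : ∫ x, (star f) x ∂AddCircle.haarAddCircle =
      starRingEnd ℂ (∫ x, f x ∂AddCircle.haarAddCircle) := by
    rw [← integral_conj]; rfl
  rw [this, Complex.conj_re]

theorem mean_mul_star (f g : C(AddCircle L, ℂ)) :
    mean (f * star g) = inner ℂ (toL2 g) (toL2 f) := by
  rw [mean_eq_integral, L2.inner_def]
  refine integral_congr_ae ?_
  filter_upwards [toL2_ae f, toL2_ae g] with x h1 h2
  rw [h1, h2]
  simp

/-- The part `∫ (|v|² / 2 - δ P(v))` of the energy. -/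
def potEnergy (p : PressureLaw) (δ : ℝ) (f : C(AddCircle L, ℂ)) : ℝ :=
  (mean ((1 / 2 : ℂ) • (f * star f)
    - (δ / 4 : ℂ) • ((twistC p f * twistC p f) * (star f * star f)))).re

theorem norm_twistC (p : PressureLaw) (f : C(AddCircle L, ℂ)) : ‖twistC p f‖ = ‖f‖ := by
  cases p
  · rfl
  · exact norm_star f

theorem abs_potEnergy_le (p : PressureLaw) {δ : ℝ} (hδ : 0 ≤ δ) (f : C(AddCircle L, ℂ)) :
    |potEnergy p δ f| ≤ 1 / 2 * ‖f‖ ^ 2 + δ / 4 * ‖f‖ ^ 4 := by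
  refine (Complex.abs_re_le_norm _).trans ((norm_mean_le _).trans ((norm_sub_le _ _).trans ?_))
  rw [norm_smul, norm_smul, norm_div, norm_div, Complex.norm_real, Real.norm_of_nonneg hδ]
  have h1 := norm_mul_le f (star f)
  have h2 := norm_mul_le (twistC p f * twistC p f) (star f * star f)
  have h3 := norm_mul_le (twistC p f) (twistC p f)
  have h4 := norm_mul_le (star f) (star f)
  rw [norm_star] at h1 h4
  rw [norm_twistC] at h3
  have h5 : ‖twistC p f * twistC p f‖ * ‖star f * star f‖ ≤ (‖f‖ * ‖f‖) * (‖f‖ * ‖f‖) := by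
    gcongr
  have h6 : ‖(1 : ℂ)‖ / ‖(2 : ℂ)‖ = 1 / 2 := by norm_num
  have h7 : ‖(4 : ℂ)‖ = 4 := by norm_num
  rw [h6, h7]
  have e1 : ‖f * star f‖ ≤ ‖f‖ ^ 2 := by rw [sq]; exact h1
  have e2 : ‖twistC p f * twistC p f * (star f * star f)‖ ≤ ‖f‖ ^ 4 :=
    (h2.trans h5).trans_eq (by ring)
  gcongr

theorem hasDerivWithinAt_star {f : ℝ → C(AddCircle L, ℂ)} {f' : C(AddCircle L, ℂ)} {s : Set ℝ}
    {t : ℝ} (h : HasDerivWithinAt f f' s t) :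
    HasDerivWithinAt (fun r => star (f r)) (star f') s t := h.star

theorem hasDerivWithinAt_re_mean {f : ℝ → C(AddCircle L, ℂ)} {f' : C(AddCircle L, ℂ)} {s : Set ℝ}
    {t : ℝ} (h : HasDerivWithinAt f f' s t) :
    HasDerivWithinAt (fun r => (mean (f r)).re) (mean f').re s t := by
  have h1 := (mean (L := L)).hasFDerivAt (x := f t) |>.restrictScalars ℝ
  have h2 := h1.comp_hasDerivWithinAt t h
  exact Complex.reCLM.hasFDerivAt.comp_hasDerivWithinAt t h2

/-- The gradient of the potential energy is minus the rescaled pressure; energy conservation rests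
on this. -/
theorem hasDerivWithinAt_potEnergy (p : PressureLaw) (δ : ℝ) {f : ℝ → C(AddCircle L, ℂ)}
    {f' : C(AddCircle L, ℂ)} {s : Set ℝ} {t : ℝ} (h : HasDerivWithinAt f f' s t) :
    HasDerivWithinAt (fun r => potEnergy p δ (f r))
      (inner ℂ (toL2 f') (toL2 (f t - (δ : ℂ) • cubic p (f t)))).re s t := by
  have hs := hasDerivWithinAt_star h
  have ht : ∃ g', HasDerivWithinAt (fun r => twistC p (f r)) g' s t ∧ g' = twistC p f' := by
    cases p
    · exact ⟨_, h, rfl⟩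
    · exact ⟨_, hs, rfl⟩
  obtain ⟨g', ht, rfl⟩ := ht
  have h1 := (h.fun_mul hs).fun_const_smul (1 / 2 : ℂ)
  have h2 := ((ht.fun_mul ht).fun_mul (hs.fun_mul hs)).fun_const_smul (δ / 4 : ℂ)
  have h3 := hasDerivWithinAt_re_mean (h1.fun_sub h2)
  refine h3.congr_deriv ?_
  rw [← mean_mul_star]
  -- For `p1` the whole derivative is half the sum of a function and its conjugate. For `p2` the
  -- quartic term depends on `star f` alone and has the right form already; only the quadratic term
  -- is symmetrized.
  cases p
  · have e : (1 / 2 : ℂ) • (f' * star (f t) + f t * star f') - (δ / 4 : ℂ) •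
        ((twistC .p1 f' * twistC .p1 (f t) + twistC .p1 (f t) * twistC .p1 f') *
          (star (f t) * star (f t)) + twistC .p1 (f t) * twistC .p1 (f t) *
          (star f' * star (f t) + star (f t) * star f')) =
        (1 / 2 : ℂ) • (star ((f t - (δ : ℂ) • cubic .p1 (f t)) * star f') +
          (f t - (δ : ℂ) • cubic .p1 (f t)) * star f') := by
      ext x
      simp [twistC, cubic]
      ring
    rw [e, map_smul, map_add]
    have := re_mean_star ((f t - (δ : ℂ) • cubic .p1 (f t)) * star f')
    have h2 : (1 / 2 : ℂ) = ((1 / 2 : ℝ) : ℂ) := by norm_num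
    rw [h2, smul_eq_mul, Complex.re_ofReal_mul, Complex.add_re, this]
    ring
  · have e : (1 / 2 : ℂ) • (f' * star (f t) + f t * star f') - (δ / 4 : ℂ) •
        ((twistC .p2 f' * twistC .p2 (f t) + twistC .p2 (f t) * twistC .p2 f') *
          (star (f t) * star (f t)) + twistC .p2 (f t) * twistC .p2 (f t) *
          (star f' * star (f t) + star (f t) * star f')) =
        (1 / 2 : ℂ) • (star (f t * star f') - f t * star f') +
          (f t - (δ : ℂ) • cubic .p2 (f t)) * star f' := by
      ext x
      simp [twistC, cubic]
      ring
    rw [e, map_add, map_smul, map_sub]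
    have := re_mean_star (f t * star f')
    simp only [smul_eq_mul, Complex.mul_re, Complex.add_re, Complex.sub_re, this]
    norm_num

theorem freq_two_pi (n : ℤ) : freq (2 * Real.pi) n = Complex.I * n := by
  rw [freq, mul_div_cancel_left₀ _ Real.two_pi_pos.ne']
  simp

/-! ### The rescaled flow and the conservation of its energy -/

/-- The curve `x = (ω, y)` solves the rescaled system on `[0, τ]`. -/
def IsFlow (p : PressureLaw) (ε δ τ : ℝ) (x : ℝ → L2 (2 * Real.pi) × L2 (2 * Real.pi)) : Prop :=
  ∀ t ∈ Icc 0 τ, HasDerivWithinAt x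
    (fieldOf ε (ε ^ 3)⁻¹ t (force p δ (etaOf ε (ε ^ 3)⁻¹ t (x t)))) (Icc 0 τ) t

namespace IsFlow

variable {p : PressureLaw} {ε δ τ : ℝ} {x : ℝ → L2 (2 * Real.pi) × L2 (2 * Real.pi)}

/-- The derivative `∂ₓ v₁` of the first component of the rescaled solution. -/
abbrev eta (ε : ℝ) (x : ℝ → L2 (2 * Real.pi) × L2 (2 * Real.pi)) (t : ℝ) : L2 (2 * Real.pi) :=
  etaOf ε (ε ^ 3)⁻¹ t (x t)

/-- The second component of the rescaled solution. -/
abbrev vel (ε : ℝ) (x : ℝ → L2 (2 * Real.pi) × L2 (2 * Real.pi)) (t : ℝ) : L2 (2 * Real.pi) :=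
  group (ε ^ 3)⁻¹ t (x t).2

theorem continuousOn (hx : IsFlow p ε δ τ x) : ContinuousOn x (Icc 0 τ) :=
  fun t ht => (hx t ht).continuousWithinAt

theorem continuousOn_eta (hx : IsFlow p ε δ τ x) : ContinuousOn (eta ε x) (Icc 0 τ) :=
  continuousOn_etaOf _ _ hx.continuousOn

theorem continuousOn_vel (hx : IsFlow p ε δ τ x) : ContinuousOn (vel ε x) (Icc 0 τ) := by
  have h := continuous_snd.comp_continuousOn hx.continuousOn
  exact continuousOn_group_comp _ continuousOn_id h

theorem hasDerivWithinAt_fst (hx : IsFlow p ε δ τ x) {t : ℝ} (ht : t ∈ Icc 0 τ) :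
    HasDerivWithinAt (fun s => (x s).1) ((Complex.I / ε) • force p δ (eta ε x t)) (Icc 0 τ) t :=
  have h := (ContinuousLinearMap.fst ℝ (L2 (2 * Real.pi)) (L2 (2 * Real.pi))).hasFDerivAt
    |>.comp_hasDerivWithinAt t (hx t ht)
  h

theorem hasDerivWithinAt_snd (hx : IsFlow p ε δ τ x) {t : ℝ} (ht : t ∈ Icc 0 τ) :
    HasDerivWithinAt (fun s => (x s).2)
      (((1 / ε ^ 2 : ℝ) : ℂ) • group (ε ^ 3)⁻¹ (-t) (force p δ (eta ε x t))) (Icc 0 τ) t :=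
  have h := (ContinuousLinearMap.snd ℝ (L2 (2 * Real.pi)) (L2 (2 * Real.pi))).hasFDerivAt
    |>.comp_hasDerivWithinAt t (hx t ht)
  h

theorem hasDerivWithinAt_coef_vel (hx : IsFlow p ε δ τ x) {t : ℝ} (ht : t ∈ Icc 0 τ) (n : ℤ) :
    HasDerivWithinAt (fun s => coef n (vel ε x s))
      (Complex.I * ((ε ^ 3)⁻¹ * n ^ 2 : ℝ) * coef n (vel ε x t) +
        ((1 / ε ^ 2 : ℝ) : ℂ) * coef n (force p δ (eta ε x t))) (Icc 0 τ) t := by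
  have h := hasDerivWithinAt_coef_group (μ := (ε ^ 3)⁻¹) (hx.hasDerivWithinAt_snd ht) n
  rwa [map_smul, map_smul, group_group_neg, smul_eq_mul] at h

/-- The forces in `ω` and in `iεv₂` cancel, leaving `∂ₜ∂ₓv₁ = -ε⁻²∂ₓ²v₂`. Two derivatives of `v₂`
are lost, so this is an equation for coefficients only. -/
theorem hasDerivWithinAt_coef_eta (hε : 0 < ε) (hx : IsFlow p ε δ τ x) {t : ℝ}
    (ht : t ∈ Icc 0 τ) (n : ℤ) :
    HasDerivWithinAt (fun s => coef n (eta ε x s))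
      ((n ^ 2 / ε ^ 2 : ℝ) * coef n (vel ε x t)) (Icc 0 τ) t := by
  have h1 := hasDerivWithinAt_coef (hx.hasDerivWithinAt_fst ht) n
  have h2 := (hx.hasDerivWithinAt_coef_vel ht n).const_mul (Complex.I * ε)
  have h3 := h1.fun_sub h2
  have e : (fun s => coef n (eta ε x s)) =
      fun s => coef n (x s).1 - Complex.I * ε * coef n (vel ε x s) := by
    ext s
    rw [eta, etaOf, map_sub, map_smul, smul_eq_mul]
  rw [e]
  refine h3.congr_deriv ?_
  rw [map_smul, smul_eq_mul]
  have hε' : (ε : ℂ) ≠ 0 := by exact_mod_cast hε.ne'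
  push_cast
  field_simp
  linear_combination (-(n : ℂ) ^ 2 * coef n (vel ε x t)) * Complex.I_sq

/-- The time derivative of the truncation of `∂ₓ v₁`. -/
theorem hasDerivWithinAt_trunc_eta (hε : 0 < ε) (hx : IsFlow p ε δ τ x) {t : ℝ}
    (ht : t ∈ Icc 0 τ) (s : Finset ℤ) :
    HasDerivWithinAt (fun r => trunc s (eta ε x r))
      (∑ n ∈ s, ((n ^ 2 / ε ^ 2 : ℝ) * coef n (vel ε x t)) • (expL n : L2 (2 * Real.pi)))
      (Icc 0 τ) t := by
  simp only [trunc_eq_sum]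
  exact HasDerivWithinAt.fun_sum fun n _ =>
    (hx.hasDerivWithinAt_coef_eta hε ht n).smul_const (expL n : L2 (2 * Real.pi))

/-- The truncation is needed because `∂ₓv₁` need not be differentiable in time with values in `L²`.
One `∂ₓ` is moved from `v₂` to the gradient mode by mode, which turns the gradient into the force.
-/
theorem hasDerivWithinAt_potEnergy (hε : 0 < ε) (hx : IsFlow p ε δ τ x) {t : ℝ}
    (ht : t ∈ Icc 0 τ) (s : Finset ℤ) :
    HasDerivWithinAt (fun r => potEnergy p δ (antideriv (trunc s (eta ε x r))))
      (1 / ε ^ 2 * (inner ℂ (trunc s (vel ε x t)) (force p δ (trunc s (eta ε x t)))).re)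
      (Icc 0 τ) t := by
  have h := VdW.hasDerivWithinAt_potEnergy p δ
    (hasDerivWithinAt_antideriv (hx.hasDerivWithinAt_trunc_eta hε ht s))
  refine h.congr_deriv ?_
  rw [← Complex.re_ofReal_mul]
  congr 1
  rw [inner_eq_tsum_coef, inner_eq_tsum_coef, ← tsum_mul_left]
  refine tsum_congr fun n => ?_
  have hd := der_force p δ (trunc s (eta ε x t)) n
  rw [hd, coef_toL2_antideriv, coef_trunc]
  have hs : coef n (∑ n ∈ s, ((n ^ 2 / ε ^ 2 : ℝ) * coef n (vel ε x t)) •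
      (expL n : L2 (2 * Real.pi))) = if n ∈ s then (n ^ 2 / ε ^ 2 : ℝ) * coef n (vel ε x t) else 0 := by
    simp [coef_expL]
  rw [hs]
  split_ifs
  · rw [map_mul, map_mul, map_inv₀, conj_freq, Complex.conj_ofReal, freq_two_pi]
    by_cases hn : n = 0
    · simp [hn]
    · have hn' : (n : ℂ) ≠ 0 := by exact_mod_cast hn
      have hε' : (ε : ℂ) ≠ 0 := by exact_mod_cast hε.ne'
      have hI := Complex.I_ne_zero
      push_cast
      field_simp
      rw [Complex.I_sq]
      ring
  · simp

/-- The group is unitary, so `y` and `v₂` have the same norm and only the force does work. -/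
theorem hasDerivWithinAt_norm_sq (hx : IsFlow p ε δ τ x) {t : ℝ} (ht : t ∈ Icc 0 τ) :
    HasDerivWithinAt (fun r => 1 / 2 * ‖(x r).2‖ ^ 2)
      (1 / ε ^ 2 * (inner ℂ (vel ε x t) (force p δ (eta ε x t))).re) (Icc 0 τ) t := by
  have h1 := hx.hasDerivWithinAt_snd ht
  have h2 := Complex.reCLM.hasFDerivAt.comp_hasDerivWithinAt t (h1.inner ℂ h1)
  have h3 := h2.const_mul (1 / 2)
  have e : ∀ r, ‖(x r).2‖ ^ 2 = (inner ℂ (x r).2 (x r).2).re := fun r =>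
    (inner_self_eq_norm_sq (𝕜 := ℂ) (x r).2).symm
  simp only [e]
  refine h3.congr_deriv ?_
  rw [← inner_conj_symm (((1 / ε ^ 2 : ℝ) : ℂ) • _), inner_smul_right, inner_group_neg]
  simp only [Complex.reCLM_apply, Complex.add_re, Complex.conj_re, Complex.re_ofReal_mul]
  ring

/-- With the potential part truncated, the energy `φ s` has derivative `ρ s`, the difference between
the exact and the truncated work. It is bounded uniformly in `s` and tends to `0` at each time, so
dominated convergence applies. -/
theorem energy_eq (hε : 0 < ε) (hδ : 0 ≤ δ) (hx : IsFlow p ε δ τ x) (hτ : 0 ≤ τ) :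
    1 / 2 * ‖(x τ).2‖ ^ 2 - potEnergy p δ (antideriv (eta ε x τ)) =
      1 / 2 * ‖(x 0).2‖ ^ 2 - potEnergy p δ (antideriv (eta ε x 0)) := by
  set φ : Finset ℤ → ℝ → ℝ := fun s t =>
    1 / 2 * ‖(x t).2‖ ^ 2 - potEnergy p δ (antideriv (trunc s (eta ε x t))) with hφ
  set ρ : Finset ℤ → ℝ → ℝ := fun s t =>
    1 / ε ^ 2 * (inner ℂ (vel ε x t) (force p δ (eta ε x t))).re -
    1 / ε ^ 2 * (inner ℂ (trunc s (vel ε x t)) (force p δ (trunc s (eta ε x t)))).re with hρ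
  have hd : ∀ s, ∀ t ∈ Icc 0 τ, HasDerivWithinAt (φ s) (ρ s t) (Icc 0 τ) t := fun s t ht =>
    (hx.hasDerivWithinAt_norm_sq ht).fun_sub (hx.hasDerivWithinAt_potEnergy hε ht s)
  have hF := continuous_force (L := 2 * Real.pi) p hδ
  have hc : ∀ s, ContinuousOn (ρ s) (Icc 0 τ) := by
    intro s
    have h1 := hx.continuousOn_vel.inner (𝕜 := ℂ) (hF.comp_continuousOn hx.continuousOn_eta)
    have h2 := ((trunc s).continuous.comp_continuousOn hx.continuousOn_vel).inner (𝕜 := ℂ)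
      (hF.comp_continuousOn ((trunc s).continuous.comp_continuousOn hx.continuousOn_eta))
    exact ((Complex.continuous_re.comp_continuousOn h1).const_smul (1 / ε ^ 2)).sub
      ((Complex.continuous_re.comp_continuousOn h2).const_smul (1 / ε ^ 2))
  have hi : ∀ s, ∫ t in (0 : ℝ)..τ, ρ s t = φ s τ - φ s 0 := by
    intro s
    refine intervalIntegral.integral_eq_sub_of_hasDerivAt_of_le hτ
      (fun t ht => (hd s t ht).continuousWithinAt)
      (fun t ht => (hd s t (Ioo_subset_Icc_self ht)).hasDerivAt (Icc_mem_nhds ht.1 ht.2)) ?_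
    exact (hc s).intervalIntegrable_of_Icc hτ
  obtain ⟨A, hA⟩ := isCompact_Icc.exists_bound_of_continuousOn hx.continuousOn_vel
  obtain ⟨B, hB⟩ := isCompact_Icc.exists_bound_of_continuousOn hx.continuousOn_eta
  have hA0 : 0 ≤ A := (norm_nonneg _).trans (hA 0 (left_mem_Icc.2 hτ))
  have hB0 : 0 ≤ B := (norm_nonneg _).trans (hB 0 (left_mem_Icc.2 hτ))
  set D := B + δ * (3 * embConst (2 * Real.pi) ^ 2 * B ^ 3)
  have hinner : ∀ f g : L2 (2 * Real.pi), ‖f‖ ≤ A → ‖g‖ ≤ B →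
      |1 / ε ^ 2 * (inner ℂ f (force p δ g)).re| ≤ 1 / ε ^ 2 * (A * D) := by
    intro f g hf hg
    rw [abs_mul, abs_of_nonneg (by positivity : 0 ≤ 1 / ε ^ 2)]
    gcongr
    refine (Complex.abs_re_le_norm _).trans ((norm_inner_le_norm _ _).trans ?_)
    have h := norm_force_le p hδ g
    have hC := embConst_nonneg (2 * Real.pi)
    have h' : ‖force p δ g‖ ≤ D := by
      refine h.trans ?_
      change _ ≤ B + δ * (3 * embConst (2 * Real.pi) ^ 2 * B ^ 3)
      gcongr
    gcongr
  have hlim : Tendsto (fun s => ∫ t in (0 : ℝ)..τ, ρ s t) atTop (𝓝 (∫ t in (0 : ℝ)..τ, (0 : ℝ))) := by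
    refine intervalIntegral.tendsto_integral_filter_of_dominated_convergence
      (fun _ => 1 / ε ^ 2 * (A * D) + 1 / ε ^ 2 * (A * D)) ?_ ?_ ?_ ?_
    · refine Eventually.of_forall fun s => ?_
      rw [uIoc_of_le hτ]
      exact ((hc s).mono Ioc_subset_Icc_self).aestronglyMeasurable measurableSet_Ioc
    · refine Eventually.of_forall fun s => Eventually.of_forall fun t ht => ?_
      rw [uIoc_of_le hτ] at ht
      have ht' := Ioc_subset_Icc_self ht
      refine (abs_sub _ _).trans (add_le_add (hinner _ _ (hA t ht') (hB t ht')) ?_)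
      exact hinner _ _ ((norm_trunc_le _ _).trans (hA t ht')) ((norm_trunc_le _ _).trans (hB t ht'))
    · exact intervalIntegrable_const
    · refine Eventually.of_forall fun t _ => ?_
      have h1 := tendsto_trunc (vel ε x t)
      have h2 := (hF.tendsto _).comp (tendsto_trunc (eta ε x t))
      have h3 := (Complex.continuous_re.tendsto _).comp (h1.inner (𝕜 := ℂ) h2)
      have h4 := (h3.const_mul (1 / ε ^ 2)).const_sub
        (1 / ε ^ 2 * (inner ℂ (vel ε x t) (force p δ (eta ε x t))).re)
      rwa [sub_self] at h4
  have hlim2 : Tendsto (fun s => φ s τ - φ s 0) atTop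
      (𝓝 ((1 / 2 * ‖(x τ).2‖ ^ 2 - potEnergy p δ (antideriv (eta ε x τ))) -
        (1 / 2 * ‖(x 0).2‖ ^ 2 - potEnergy p δ (antideriv (eta ε x 0))))) := by
    have hpot : Continuous (potEnergy p δ : C(AddCircle (2 * Real.pi), ℂ) → ℝ) := by
      have ht : Continuous (twistC p : C(AddCircle (2 * Real.pi), ℂ) → _) := by
        cases p
        · exact continuous_id
        · exact continuous_star
      have h1 : Continuous fun f : C(AddCircle (2 * Real.pi), ℂ) => (1 / 2 : ℂ) • (f * star f)
          - (δ / 4 : ℂ) • ((twistC p f * twistC p f) * (star f * star f)) :=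
        by fun_prop
      exact Complex.continuous_re.comp (mean.continuous.comp h1)
    have h : ∀ t, Tendsto (fun s => φ s t) atTop
        (𝓝 (1 / 2 * ‖(x t).2‖ ^ 2 - potEnergy p δ (antideriv (eta ε x t)))) := fun t =>
      (((hpot.comp antideriv.continuous).tendsto _).comp (tendsto_trunc (eta ε x t))).const_sub _
    exact (h τ).sub (h 0)
  simp only [hi, intervalIntegral.integral_zero] at hlim
  exact sub_eq_zero.1 (tendsto_nhds_unique hlim2 hlim)

end IsFlow

/-! ### A priori bounds uniform in `ε` -/

/-- At the first time `t₀` with `m ≥ 1`, the intermediate value theorem gives `m ≤ 1` up to `t₀`,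
and the hypothesis then contradicts `m t₀ ≥ 1`. -/
theorem le_one_of_bootstrap {m : ℝ → ℝ} {T : ℝ} (hm : ContinuousOn m (Icc 0 T)) (h0 : m 0 < 1)
    (h : ∀ t ∈ Icc 0 T, (∀ s ∈ Icc 0 t, m s ≤ 1) → m t < 1) : ∀ t ∈ Icc 0 T, m t ≤ 1 := by
  by_contra! hcon
  obtain ⟨t, ht, hmt⟩ := hcon
  set S := Icc 0 T ∩ m ⁻¹' Ici 1 with hS
  have hSc : IsCompact S := (isCompact_Icc).of_isClosed_subset
    (hm.preimage_isClosed_of_isClosed isClosed_Icc isClosed_Ici) inter_subset_left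
  obtain ⟨t₀, ⟨ht₀, hmt₀⟩, hmin⟩ := hSc.exists_isLeast ⟨t, ht, hmt.le⟩
  have hlt : ∀ s ∈ Icc 0 t₀, m s ≤ 1 := by
    intro s hs
    by_contra! hs1
    have hsub : Icc 0 s ⊆ Icc 0 T := Icc_subset_Icc_right (hs.2.trans ht₀.2)
    obtain ⟨r, hr, hmr⟩ := intermediate_value_Icc hs.1 (hm.mono hsub) ⟨h0.le, hs1.le⟩
    have hrs : r ≠ s := fun e => by rw [e] at hmr; linarith
    have hrlt : r < s := lt_of_le_of_ne hr.2 hrs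
    have : t₀ ≤ r := hmin ⟨hsub hr, hmr.ge⟩
    linarith [hs.2]
  exact absurd (h t₀ ht₀ hlt) (not_lt.2 hmt₀)

/-- Multiplication by `e^{-ict}` preserves norms and removes the rotation, however large `c` is. -/
theorem norm_le_of_rotating {f h : ℝ → L2 L} {c τ B : ℝ} (hτ : 0 ≤ τ)
    (hf : ∀ t ∈ Icc 0 τ, HasDerivWithinAt f ((Complex.I * c) • f t + h t) (Icc 0 τ) t)
    (hB : ∀ t ∈ Icc 0 τ, ‖h t‖ ≤ B) : ‖f τ‖ ≤ ‖f 0‖ + τ * B := by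
  set e : ℝ → ℂ := fun t => Complex.exp (Complex.I * (-c * t : ℝ)) with he
  have hd : ∀ t ∈ Icc 0 τ, HasDerivWithinAt (fun s => e s • f s) (e t • h t) (Icc 0 τ) t := by
    intro t ht
    have := (hasDerivAt_exp_I_mul (-c) t).hasDerivWithinAt (s := Icc 0 τ) |>.fun_smul (hf t ht)
    refine this.congr_deriv ?_
    rw [he, smul_add, smul_smul, add_right_comm, ← add_smul]
    convert zero_add _
    rw [← zero_smul ℂ (f t)]
    congr 1
    push_cast
    ring
  have hn : ∀ t, ‖e t‖ = 1 := fun t => norm_exp_I_mul _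
  have := Convex.norm_image_sub_le_of_norm_hasDerivWithin_le (C := B) hd
    (fun t ht => by rw [norm_smul, hn, one_mul]; exact hB t ht)
    (convex_Icc 0 τ) (left_mem_Icc.2 hτ) (right_mem_Icc.2 hτ)
  have h2 := norm_le_norm_add_norm_sub' (e τ • f τ) (e 0 • f 0)
  rw [norm_smul, norm_smul, hn, hn, one_mul, one_mul] at h2
  rw [sub_zero, Real.norm_of_nonneg hτ] at this
  linarith

/-- The differential of `cubicDeriv` for the second law. -/
def cubicDiff (a b : L2 L) : L2 L :=
  trilin (conjL b) (conjL a) (conjL a) + trilin (conjL a) (conjL b) (conjL a) +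
    trilin (conjL a) (conjL a) (conjL b)

theorem hasDerivWithinAt_cubicDeriv {f : ℝ → L2 L} {f' : L2 L} {s : Set ℝ} {t : ℝ}
    (h : HasDerivWithinAt f f' s t) :
    HasDerivWithinAt (fun r => cubicDeriv .p2 (f r)) (cubicDiff (f t) f') s t :=
  hasDerivWithinAt_trilin (hasDerivWithinAt_conjL h) (hasDerivWithinAt_conjL h)
    (hasDerivWithinAt_conjL h)

theorem norm_cubicDiff_le (a b : L2 L) :
    ‖cubicDiff a b‖ ≤ 9 * embConst L ^ 2 * ‖a‖ ^ 2 * ‖b‖ := by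
  have h1 := norm_trilin_le (conjL b) (conjL a) (conjL a)
  have h2 := norm_trilin_le (conjL a) (conjL b) (conjL a)
  have h3 := norm_trilin_le (conjL a) (conjL a) (conjL b)
  simp only [norm_conjL] at h1 h2 h3
  refine norm_add₃_le.trans ?_
  linarith

/-- The cubic term of the second law has degree three in the conjugate of `a`, so an infinitesimal
rotation of `a` turns it three times as fast backwards. -/
theorem cubicDiff_rotate_add (a b : L2 L) (c : ℝ) :
    cubicDiff a ((Complex.I * c) • a + b) =
      -(3 * (Complex.I * c)) • cubicDeriv .p2 a + cubicDiff a b := by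
  have h : ∀ x : L2 L, (Complex.I * c) • x + b = b - (-(Complex.I * c)) • x := fun x => by
    rw [neg_smul]; abel
  have s1 := trilin_smul (Complex.I * c) 1 1 (conjL a) (conjL a) (conjL a)
  have s2 := trilin_smul 1 (Complex.I * c) 1 (conjL a) (conjL a) (conjL a)
  have s3 := trilin_smul 1 1 (Complex.I * c) (conjL a) (conjL a) (conjL a)
  simp only [one_smul, one_mul, mul_one] at s1 s2 s3
  have e : starRingEnd ℂ (-(Complex.I * c)) = Complex.I * c := by simp
  simp only [cubicDiff, cubicDeriv, twist, h, map_sub, conjL_smul, e, trilin_sub_left,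
    trilin_sub_mid, trilin_sub_right, s1, s2, s3]
  have : (3 * (Complex.I * c)) • trilin (conjL a) (conjL a) (conjL a) =
      (Complex.I * c) • trilin (conjL a) (conjL a) (conjL a) +
      (Complex.I * c) • trilin (conjL a) (conjL a) (conjL a) +
      (Complex.I * c) • trilin (conjL a) (conjL a) (conjL a) := by
    rw [← add_smul, ← add_smul]; ring_nf
  rw [neg_smul, this]
  abel

namespace IsFlow

variable {p : PressureLaw} {ε δ τ : ℝ} {x : ℝ → L2 (2 * Real.pi) × L2 (2 * Real.pi)}

theorem coef_zero_eq {a : ℝ → L2 L} {b : ℝ → L2 L}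
    (h : ∀ t ∈ Icc 0 τ, HasDerivWithinAt a (b t) (Icc 0 τ) t) (hb : ∀ t, coef 0 (b t) = 0)
    {t : ℝ} (ht : t ∈ Icc 0 τ) : coef 0 (a t) = coef 0 (a 0) := by
  have := Convex.norm_image_sub_le_of_norm_hasDerivWithin_le (C := 0)
    (fun t ht => hasDerivWithinAt_coef (h t ht) 0) (fun t _ => by rw [hb, norm_zero])
    (convex_Icc 0 τ) (left_mem_Icc.2 (ht.1.trans ht.2)) ht
  simpa [sub_eq_zero] using this

theorem meanZero_fst (hx : IsFlow p ε δ τ x) (h0 : coef 0 (x 0).1 = 0) {t : ℝ}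
    (ht : t ∈ Icc 0 τ) : meanZero (x t).1 = (x t).1 := by
  apply meanZero_eq_self
  rw [← h0]
  refine coef_zero_eq (fun t ht => hx.hasDerivWithinAt_fst ht) (fun t => ?_) ht
  rw [map_smul, coef_zero_force, smul_zero]

/-- The evolution of `ω` is a rotation up to bounded terms and to the cubic force. -/
theorem hasDerivWithinAt_fst' (hε : 0 < ε) (hx : IsFlow p ε δ τ x) (h0 : coef 0 (x 0).1 = 0)
    {t : ℝ} (ht : t ∈ Icc 0 τ) :
    HasDerivWithinAt (fun s => (x s).1) ((Complex.I * (1 / ε : ℝ)) • (x t).1 +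
      (meanZero (vel ε x t) - (Complex.I * (δ / ε : ℝ)) • cubicDeriv p (eta ε x t)))
      (Icc 0 τ) t := by
  refine (hx.hasDerivWithinAt_fst ht).congr_deriv ?_
  have hε' : (ε : ℂ) ≠ 0 := by exact_mod_cast hε.ne'
  have e : meanZero (eta ε x t) = (x t).1 - (Complex.I * ε) • meanZero (vel ε x t) := by
    rw [eta, etaOf, map_sub, map_smul, hx.meanZero_fst h0 ht]
  have e1 : (Complex.I / ε) * (Complex.I * ε) = -1 := by
    field_simp; exact Complex.I_sq
  have e2 : Complex.I / ε = Complex.I * (1 / ε : ℝ) := by push_cast; ring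
  have e3 : Complex.I / ε * δ = Complex.I * (δ / ε : ℝ) := by push_cast; ring
  rw [force, e, smul_sub, smul_sub, smul_smul, smul_smul, e1, e3, e2, neg_one_smul]
  abel

/-- Here `δ = ε`, so the cubic term enters with coefficient of modulus `1` and no cancellation is
needed; `24 = 3 · 2³`. -/
theorem norm_fst_le_p1 (hε : 0 < ε) (hx : IsFlow .p1 ε ε τ x) (h0 : coef 0 (x 0).1 = 0)
    (hτ : 0 ≤ τ) {C R : ℝ} (hC : embConst (2 * Real.pi) ≤ C)
    (h2 : ∀ t ∈ Icc 0 τ, ‖(x t).2‖ ≤ R) (h3 : ∀ t ∈ Icc 0 τ, ‖eta ε x t‖ ≤ 2) :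
    ‖(x τ).1‖ ≤ ‖(x 0).1‖ + τ * (R + 24 * C ^ 2) := by
  refine norm_le_of_rotating (f := fun t => (x t).1) hτ
    (fun t ht => hx.hasDerivWithinAt_fst' hε h0 ht) fun t ht => ?_
  have hC0 := embConst_nonneg (2 * Real.pi)
  refine (norm_sub_le _ _).trans (add_le_add ?_ ?_)
  · exact (norm_meanZero_le _).trans ((norm_group _ _ _).trans_le (h2 t ht))
  · rw [div_self hε.ne', Complex.ofReal_one, mul_one, norm_smul, Complex.norm_I, one_mul]
    refine (norm_cubicDeriv_le _ _).trans ?_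
    calc 3 * embConst (2 * Real.pi) ^ 2 * ‖eta ε x t‖ ^ 3 ≤ 3 * C ^ 2 * 2 ^ 3 := by
          gcongr; exact h3 t ht
      _ = 24 * C ^ 2 := by ring

/-- The cubic term has the large coefficient `δ/ε`. The corrected unknown `f = ω - (δ/4) N(ω)`, with
`N = cubicDeriv .p2`, rotates up to a bounded error `h`, and the correction is itself of size `δ`.
-/
theorem norm_fst_le_p2 (hε : 0 < ε) (hδ : 0 ≤ δ) (hδ1 : δ ≤ 1) (hδε : δ ^ 2 = ε)
    (hx : IsFlow .p2 ε δ τ x)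
    (h0 : coef 0 (x 0).1 = 0) (hτ : 0 ≤ τ) {C R : ℝ} (hC : embConst (2 * Real.pi) ≤ C)
    (h1 : ∀ t ∈ Icc 0 τ, ‖(x t).1‖ ≤ 1)
    (h2 : ∀ t ∈ Icc 0 τ, ‖(x t).2‖ ≤ R) (h3 : ∀ t ∈ Icc 0 τ, ‖eta ε x t‖ ≤ 2) :
    ‖(x τ).1‖ ≤ ‖(x 0).1‖ + τ * (R + 36 * C ^ 2 * R + 9 * C ^ 2 * (R + 24 * C ^ 2))
      + 3 * C ^ 2 * δ := by
  have hC0 := embConst_nonneg (2 * Real.pi)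
  have hR : 0 ≤ R := (norm_nonneg _).trans (h2 0 (left_mem_Icc.2 hτ))
  set g : ℝ → L2 (2 * Real.pi) := fun t =>
    meanZero (vel ε x t) - (Complex.I * (δ / ε : ℝ)) • cubicDeriv .p2 (eta ε x t) with hg
  set h : ℝ → L2 (2 * Real.pi) := fun t => meanZero (vel ε x t)
    - (Complex.I * (δ / ε : ℝ)) • (cubicDeriv .p2 (eta ε x t) - cubicDeriv .p2 (x t).1)
    - ((δ / 4 : ℝ) : ℂ) • cubicDiff (x t).1 (g t) with hh
  set f : ℝ → L2 (2 * Real.pi) := fun t =>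
    (x t).1 - ((δ / 4 : ℝ) : ℂ) • cubicDeriv .p2 (x t).1 with hf
  have hN : ∀ t ∈ Icc 0 τ, ‖((δ / 4 : ℝ) : ℂ) • cubicDeriv .p2 (x t).1‖ ≤ 3 / 4 * C ^ 2 * δ := by
    intro t ht
    rw [norm_smul, Complex.norm_real, Real.norm_of_nonneg (by positivity)]
    have h4 : ‖cubicDeriv .p2 (x t).1‖ ≤ 3 * C ^ 2 * 1 ^ 3 := by
      refine (norm_cubicDeriv_le _ _).trans ?_
      gcongr
      exact h1 t ht
    calc δ / 4 * ‖cubicDeriv .p2 (x t).1‖ ≤ δ / 4 * (3 * C ^ 2 * 1 ^ 3) := by gcongr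
      _ = _ := by ring
  have hv : ∀ t ∈ Icc 0 τ, ‖meanZero (vel ε x t)‖ ≤ R := fun t ht =>
    (norm_meanZero_le _).trans ((norm_group _ _ _).trans_le (h2 t ht))
  -- This balance keeps the correction harmless: `g` has size `δ/ε`, and the differential of `(δ/4)
  -- N` in the direction `g` stays bounded.
  have hδε' : δ / ε * δ = 1 := by
    rw [div_mul_eq_mul_div, ← sq, hδε, div_self hε.ne']
  have hnI : ∀ r : ℝ, 0 ≤ r → ‖Complex.I * (r : ℂ)‖ = r := fun r hr => by
    rw [norm_mul, Complex.norm_I, one_mul, Complex.norm_real, Real.norm_of_nonneg hr]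
  have hgb : ∀ t ∈ Icc 0 τ, δ * ‖g t‖ ≤ R + 24 * C ^ 2 := by
    intro t ht
    have h4 : ‖cubicDeriv .p2 (eta ε x t)‖ ≤ 3 * C ^ 2 * 2 ^ 3 := by
      refine (norm_cubicDeriv_le _ _).trans ?_
      gcongr
      exact h3 t ht
    have h5 : ‖g t‖ ≤ R + δ / ε * (3 * C ^ 2 * 2 ^ 3) := by
      refine (norm_sub_le _ _).trans (add_le_add (hv t ht) ?_)
      rw [norm_smul, hnI _ (by positivity)]
      gcongr
    calc δ * ‖g t‖ ≤ δ * (R + δ / ε * (3 * C ^ 2 * 2 ^ 3)) := by gcongr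
      _ = δ * R + (δ / ε * δ) * (24 * C ^ 2) := by ring
      _ ≤ 1 * R + 1 * (24 * C ^ 2) := by rw [hδε']; gcongr
      _ = _ := by ring
  have hd : ∀ t ∈ Icc 0 τ,
      HasDerivWithinAt f ((Complex.I * (1 / ε : ℝ)) • f t + h t) (Icc 0 τ) t := by
    intro t ht
    have hω := hx.hasDerivWithinAt_fst' hε h0 ht
    have hω2 := (hasDerivWithinAt_cubicDeriv hω).fun_const_smul ((δ / 4 : ℝ) : ℂ)
    refine (hω.fun_sub hω2).congr_deriv ?_
    simp only [hf, hh]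
    rw [cubicDiff_rotate_add]
    simp only [smul_add, smul_sub, smul_smul, hg]
    -- The frequencies `1/ε` and `-3/ε` differ by `4/ε`, so the coefficient `δ/4` produces exactly
    -- the term `(δ/ε) N(ω)` that is to be cancelled.
    have e : ((δ / 4 : ℝ) : ℂ) * -(3 * (Complex.I * (1 / ε : ℝ))) =
        Complex.I * (1 / ε : ℝ) * (δ / 4 : ℝ) - Complex.I * (δ / ε : ℝ) := by push_cast; ring
    rw [e, sub_smul]
    abel
  have hb : ∀ t ∈ Icc 0 τ, ‖h t‖ ≤ R + 36 * C ^ 2 * R + 9 * C ^ 2 * (R + 24 * C ^ 2) := by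
    intro t ht
    refine (norm_sub_le _ _).trans (add_le_add ((norm_sub_le _ _).trans
      (add_le_add (hv t ht) ?_)) ?_)
    · rw [norm_smul, hnI _ (by positivity)]
      have h5 := norm_cubicDeriv_sub_le .p2 (eta ε x t) (x t).1 (h3 t ht)
        ((h1 t ht).trans one_le_two)
      -- Replacing `∂ₓv₁` by `ω` costs `εv₂`, which compensates the factor `1/ε`.
      have h6 : ‖eta ε x t - (x t).1‖ ≤ ε * R := by
        rw [eta, etaOf, sub_sub_cancel_left, norm_neg, norm_smul, norm_group, hnI _ hε.le]
        gcongr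
        exact h2 t ht
      calc δ / ε * ‖cubicDeriv .p2 (eta ε x t) - cubicDeriv .p2 (x t).1‖
          ≤ δ / ε * (9 * C ^ 2 * 2 ^ 2 * (ε * R)) := by
            refine mul_le_mul_of_nonneg_left (h5.trans ?_) (by positivity)
            gcongr
        _ = δ * (36 * C ^ 2 * R) := by field_simp; ring
        _ ≤ 1 * (36 * C ^ 2 * R) := by gcongr
        _ = _ := one_mul _
    · rw [norm_smul, Complex.norm_real, Real.norm_of_nonneg (by positivity)]
      have h5 : ‖cubicDiff (x t).1 (g t)‖ ≤ 9 * C ^ 2 * 1 ^ 2 * ‖g t‖ := by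
        refine (norm_cubicDiff_le _ _).trans ?_
        gcongr
        exact h1 t ht
      have h6 := hgb t ht
      calc δ / 4 * ‖cubicDiff (x t).1 (g t)‖ ≤ δ / 4 * (9 * C ^ 2 * 1 ^ 2 * ‖g t‖) := by gcongr
        _ = 9 / 4 * C ^ 2 * (δ * ‖g t‖) := by ring
        _ ≤ 9 * C ^ 2 * (R + 24 * C ^ 2) := by gcongr; norm_num
  have key := norm_le_of_rotating hτ hd hb
  have k1 := norm_sub_norm_le (x τ).1 (((δ / 4 : ℝ) : ℂ) • cubicDeriv .p2 (x τ).1)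
  have k2 := norm_sub_le (x 0).1 (((δ / 4 : ℝ) : ℂ) • cubicDeriv .p2 (x 0).1)
  have k3 := hN τ (right_mem_Icc.2 hτ)
  have k4 := hN 0 (left_mem_Icc.2 hτ)
  have k5 : 0 ≤ C ^ 2 * δ := by positivity
  simp only [hf] at key
  linarith

/-- By conservation, `½‖v₂‖²` grows by at most two bounds of the potential energy: `‖v₂‖² ≤ 1 + 8C²
+ 16C⁴ < (6C²)²`. -/
theorem norm_snd_lt (hε : 0 < ε) (hδ : 0 ≤ δ) (hδ1 : δ ≤ 1) (hx : IsFlow p ε δ τ x) (hτ : 0 ≤ τ)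
    {C : ℝ} (hC : embConst (2 * Real.pi) ≤ C) (hC1 : 1 ≤ C) (h0 : ‖(x 0).2‖ ≤ 1)
    (h3 : ∀ t ∈ Icc 0 τ, ‖eta ε x t‖ ≤ 2) : ‖(x τ).2‖ < 6 * C ^ 2 := by
  have hE := hx.energy_eq hε hδ hτ
  have hb : ∀ t ∈ Icc 0 τ, |potEnergy p δ (antideriv (eta ε x t))| ≤ 2 * C ^ 2 + 4 * C ^ 4 := by
    intro t ht
    have h4 : ‖antideriv (eta ε x t)‖ ≤ C * 2 := by
      refine (norm_antideriv_le _).trans ?_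
      gcongr
      exact h3 t ht
    calc _ ≤ 1 / 2 * ‖antideriv (eta ε x t)‖ ^ 2 + δ / 4 * ‖antideriv (eta ε x t)‖ ^ 4 :=
          abs_potEnergy_le p hδ _
      _ ≤ 1 / 2 * (C * 2) ^ 2 + 1 / 4 * (C * 2) ^ 4 := by gcongr
      _ = _ := by ring
  have h5 := abs_le.1 (hb τ (right_mem_Icc.2 hτ))
  have h6 := abs_le.1 (hb 0 (left_mem_Icc.2 hτ))
  have h7 : ‖(x 0).2‖ ^ 2 ≤ 1 := pow_le_one₀ (norm_nonneg _) h0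
  have h8 : 1 ≤ C ^ 2 := one_le_pow₀ hC1
  refine lt_of_pow_lt_pow_left₀ 2 (by positivity) ?_
  nlinarith [h5.1, h5.2, h6.1, h6.2]

end IsFlow

/-! ### A lifespan independent of `ε` -/

/-- The size of the cubic part of the pressure in the rescaled system. -/
def coupling : PressureLaw → ℝ → ℝ
  | .p1, ε => ε
  | .p2, ε => Real.sqrt ε

theorem coupling_eq_sq (p : PressureLaw) {ε : ℝ} (hε : 0 < ε) :
    coupling p ε = (ε ^ p.exponent) ^ 2 := by
  rw [← Real.rpow_natCast, ← Real.rpow_mul hε.le]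
  cases p
  · norm_num [coupling, PressureLaw.exponent]
  · rw [coupling, Real.sqrt_eq_rpow]
    norm_num [PressureLaw.exponent]

theorem coupling_nonneg (p : PressureLaw) {ε : ℝ} (hε : 0 < ε) : 0 ≤ coupling p ε := by
  cases p
  · exact hε.le
  · exact Real.sqrt_nonneg _

theorem exists_flow : ∃ T : ℝ, 0 < T ∧ ∃ ε₀ : ℝ, 0 < ε₀ ∧ ∀ (p : PressureLaw) (ε : ℝ), 0 < ε →
    ε < ε₀ → ∀ x₀ : L2 (2 * Real.pi) × L2 (2 * Real.pi), coef 0 x₀.1 = 0 → ‖x₀.1‖ ≤ 1 / 3 →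
      ‖x₀.2‖ ≤ 1 → ∃ x : ℝ → L2 (2 * Real.pi) × L2 (2 * Real.pi), x 0 = x₀ ∧
        IsFlow p ε (coupling p ε) T x := by
  set C : ℝ := 1 + embConst (2 * Real.pi) with hCdef
  have hC0 := embConst_nonneg (2 * Real.pi)
  have hC1 : 1 ≤ C := by linarith
  have hC : embConst (2 * Real.pi) ≤ C := by linarith
  have hCpos : 0 < C := by linarith
  have hC2 : 1 ≤ C ^ 2 := one_le_pow₀ hC1
  set R : ℝ := 6 * C ^ 2 with hR
  have hRpos : 0 < R := by positivity
  set B : ℝ := (R + 36 * C ^ 2 * R + 9 * C ^ 2 * (R + 24 * C ^ 2)) + (R + 24 * C ^ 2) with hB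
  have hBpos : 0 < B := by positivity
  -- `B` dominates the growth rates of `‖ω‖` for both laws, so `‖ω‖` gains at most `1/3` on `[0,
  -- T]`. The square in `ε₀` makes both `ε` and `√ε` at most `1 / (60 C²)`.
  refine ⟨1 / (3 * B), by positivity, (1 / (60 * C ^ 2)) ^ 2, by positivity, ?_⟩
  intro p ε hε hε₀ x₀ hx00 hx01 hx02
  set T : ℝ := 1 / (3 * B) with hT
  have hTpos : 0 ≤ T := by positivity
  have hTB : T * B = 1 / 3 := by rw [hT]; field_simp
  set δ := coupling p ε with hδdef
  have hδ : 0 ≤ δ := coupling_nonneg p hε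
  have hsmall : 1 / (60 * C ^ 2) ≤ 1 / 60 := by
    gcongr
    linarith
  have hs0 : 0 < 1 / (60 * C ^ 2) := by positivity
  have hε1 : ε ≤ 1 / (60 * C ^ 2) := hε₀.le.trans (by nlinarith)
  have hδ1 : δ ≤ 1 / (60 * C ^ 2) := by
    rw [hδdef]
    cases p
    · exact hε1
    · exact Real.sqrt_le_iff.2 ⟨hs0.le, hε₀.le⟩
  have hCs : C ^ 2 * (1 / (60 * C ^ 2)) = 1 / 60 := by field_simp
  have hεR : ε * R ≤ 1 / 10 := by
    calc ε * R ≤ 1 / (60 * C ^ 2) * R := by gcongr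
      _ = 6 * (C ^ 2 * (1 / (60 * C ^ 2))) := by rw [hR]; ring
      _ = 1 / 10 := by rw [hCs]; norm_num
  have hCδ : 3 * C ^ 2 * δ ≤ 1 / 20 := by
    calc 3 * C ^ 2 * δ ≤ 3 * C ^ 2 * (1 / (60 * C ^ 2)) := by gcongr
      _ = 3 * (C ^ 2 * (1 / (60 * C ^ 2))) := by ring
      _ = 1 / 20 := by rw [hCs]; norm_num
  -- Radius `2` leaves room: as long as `m ≤ 1`, `‖∂ₓv₁‖ ≤ 1 + εR ≤ 1 + 1/10`, so the cut-off is not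
  -- active.
  obtain ⟨x, hx0, hx⟩ := exists_solution_cutoff p hε hδ (ε ^ 3)⁻¹ (zero_lt_two (α := ℝ)) hTpos x₀
  refine ⟨x, hx0, ?_⟩
  have hxc : ContinuousOn x (Icc 0 T) := fun t ht => (hx t ht).continuousWithinAt
  set m : ℝ → ℝ := fun t => max ‖(x t).1‖ (‖(x t).2‖ / R) with hm
  have hmc : ContinuousOn m (Icc 0 T) := by
    have h1 := (continuous_norm.comp continuous_fst).comp_continuousOn hxc
    have h2 := (continuous_norm.comp continuous_snd).comp_continuousOn hxc
    exact ContinuousOn.sup h1 (ContinuousOn.div_const h2 R)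
  have hm0 : m 0 < 1 := by
    rw [hm]
    simp only [hx0]
    refine max_lt (by linarith) ((div_lt_one hRpos).2 ?_)
    linarith
  have hηle : ∀ t, m t ≤ 1 → ‖(x t).1‖ ≤ 1 ∧ ‖(x t).2‖ ≤ R ∧ ‖etaOf ε (ε ^ 3)⁻¹ t (x t)‖ ≤ 2 := by
    intro t ht
    have h1 := (le_max_left _ _).trans ht
    have h2 := (div_le_one hRpos).1 ((le_max_right _ _).trans ht)
    refine ⟨h1, h2, (norm_etaOf_le hε _ _ _).trans ?_⟩
    have : ε * ‖(x t).2‖ ≤ ε * R := by gcongr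
    linarith
  have hflow : ∀ t ∈ Icc 0 T, (∀ s ∈ Icc 0 t, m s ≤ 1) → IsFlow p ε δ t x := by
    intro t ht hs s hs'
    have h := (hx s ⟨hs'.1, hs'.2.trans ht.2⟩).mono (Icc_subset_Icc_right ht.2)
    rwa [retract_of_norm_le zero_lt_two (hηle s (hs s hs')).2.2] at h
  have hmT : ∀ t ∈ Icc 0 T, m t ≤ 1 := by
    refine le_one_of_bootstrap hmc hm0 fun t ht hs => ?_
    have hf := hflow t ht hs
    have b1 : ∀ s ∈ Icc 0 t, ‖(x s).1‖ ≤ 1 := fun s h => (hηle s (hs s h)).1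
    have b2 : ∀ s ∈ Icc 0 t, ‖(x s).2‖ ≤ R := fun s h => (hηle s (hs s h)).2.1
    have b3 : ∀ s ∈ Icc 0 t, ‖IsFlow.eta ε x s‖ ≤ 2 := fun s h => (hηle s (hs s h)).2.2
    have h00 : coef 0 (x 0).1 = 0 := by rw [hx0, hx00]
    -- For `ω`: initial size `1/3`, growth `1/3` and, for `p2` only, normal form error `1/20` add up
    -- to less than `1`. For `v₂`: the energy bound is strict.
    refine max_lt ?_ ((div_lt_one hRpos).2 ?_)
    · have htB : t * B ≤ 1 / 3 := by
        rw [← hTB]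
        gcongr
        exact ht.2
      have hn0 : ‖(x 0).1‖ ≤ 1 / 3 := by rw [hx0]; exact hx01
      cases p with
      | p1 =>
        have := hf.norm_fst_le_p1 hε h00 ht.1 hC b2 b3
        have h4 : t * (R + 24 * C ^ 2) ≤ t * B := by
          have := ht.1
          gcongr
          rw [hB]
          have : 0 ≤ R + 36 * C ^ 2 * R + 9 * C ^ 2 * (R + 24 * C ^ 2) := by positivity
          linarith
        linarith
      | p2 =>
        have := hf.norm_fst_le_p2 hε hδ (by linarith) (Real.sq_sqrt hε.le) h00 ht.1 hC b1 b2 b3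
        have h4 : t * (R + 36 * C ^ 2 * R + 9 * C ^ 2 * (R + 24 * C ^ 2)) ≤ t * B := by
          have := ht.1
          gcongr
          rw [hB]
          have : 0 ≤ R + 24 * C ^ 2 := by positivity
          linarith
        linarith
    · exact hf.norm_snd_lt hε hδ (by linarith) ht.1 hC hC1 (by rw [hx0]; exact hx02) b3
  exact hflow T (right_mem_Icc.2 hTpos) hmT

/-! ### Rescaling to the circle of length `L` -/

theorem ae_haar_iff_ae_volume {P : AddCircle L → Prop} :
    (∀ᵐ θ ∂AddCircle.haarAddCircle, P θ) ↔ ∀ᵐ θ : AddCircle L, P θ := by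
  have hL : ENNReal.ofReal L ≠ 0 := by simpa using (Fact.out : (0 : ℝ) < L)
  rw [AddCircle.volume_eq_smul_haarAddCircle, Measure.ae_ennreal_smul_measure_eq hL]

theorem ae_line_of_ae_circle {P : AddCircle L → Prop}
    (h : ∀ᵐ θ ∂AddCircle.haarAddCircle, P θ) : ∀ᵐ x : ℝ, P (x : AddCircle L) := by
  rw [ae_haar_iff_ae_volume] at h
  have h1 : ∀ k : ℤ, ∀ᵐ x : ℝ ∂volume.restrict (Ioc (k • L) ((k + 1) • L)), P (x : AddCircle L) := by
    intro k
    have hk : (k + 1) • L = k • L + L := by rw [add_smul, one_smul]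
    rw [hk]
    exact (AddCircle.measurePreserving_mk L (k • L)).quasiMeasurePreserving.ae h
  rw [← Measure.restrict_univ (μ := (volume : Measure ℝ)),
    ← iUnion_Ioc_zsmul (Fact.out : (0 : ℝ) < L), ae_restrict_iUnion_iff]
  exact h1

theorem ae_circle_of_ae_line {P : AddCircle L → Prop} (hP : MeasurableSet {θ | P θ})
    (h : ∀ᵐ x : ℝ, P (x : AddCircle L)) : ∀ᵐ θ ∂AddCircle.haarAddCircle, P θ := by
  rw [ae_haar_iff_ae_volume]
  have hm := AddCircle.measurePreserving_mk L 0
  rw [← hm.map_eq, ae_map_iff hm.measurable.aemeasurable hP]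
  exact ae_restrict_of_ae h

theorem IsRescaling.unique {a b : ℝ} {f : L2 (2 * Real.pi)} {g₁ g₂ : L2 L}
    (h₁ : IsRescaling a b f g₁) (h₂ : IsRescaling a b f g₂) : g₁ = g₂ := by
  refine Lp.ext (ae_circle_of_ae_line ?_ ?_)
  · exact measurableSet_eq_fun (Lp.stronglyMeasurable g₁).measurable
      (Lp.stronglyMeasurable g₂).measurable
  · filter_upwards [h₁, h₂] with x hx₁ hx₂
    rw [hx₁, hx₂]

/-- The covering `x ↦ x / b` of the circle of length `2π` by the circle of length `2π b N`. -/
def scaleHom {b : ℝ} (N : ℕ) (hb : b ≠ 0) (hL : L = N * (2 * Real.pi * b)) :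
    AddCircle L →+ AddCircle (2 * Real.pi) :=
  QuotientAddGroup.map _ _ (AddMonoidHom.mulLeft b⁻¹) (by
    rw [AddSubgroup.zmultiples_le, AddSubgroup.mem_comap, AddMonoidHom.coe_mulLeft,
      AddSubgroup.mem_zmultiples_iff]
    refine ⟨N, ?_⟩
    rw [hL, zsmul_eq_mul]
    push_cast
    field_simp)

section scale

variable {b : ℝ} {N : ℕ} (hb : b ≠ 0) (hL : L = N * (2 * Real.pi * b))

theorem scaleHom_coe (x : ℝ) :
    scaleHom N hb hL (x : AddCircle L) = ((x / b : ℝ) : AddCircle (2 * Real.pi)) := by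
  rw [div_eq_inv_mul]; rfl

theorem continuous_scaleHom : Continuous (scaleHom N hb hL) := by
  refine continuous_coinduced_dom.mpr ?_
  exact (AddCircle.continuous_mk' _).comp (continuous_const_mul b⁻¹)

/-- A continuous surjective homomorphism of compact groups carries normalized Haar measure to
normalized Haar measure. Hence composition with it is isometric on `L²`. -/
theorem measurePreserving_scaleHom :
    MeasurePreserving (scaleHom N hb hL) AddCircle.haarAddCircle AddCircle.haarAddCircle := by
  refine AddMonoidHom.measurePreserving (continuous_scaleHom hb hL) ?_ (by simp)
  intro y
  induction y using QuotientAddGroup.induction_on with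
  | H y =>
    refine ⟨((y * b : ℝ) : AddCircle L), ?_⟩
    rw [scaleHom_coe, mul_div_cancel_right₀ _ hb]

/-- The composition of a function with `x ↦ x / b`. -/
def pull : L2 (2 * Real.pi) →L[ℂ] L2 L :=
  (Lp.compMeasurePreservingₗᵢ ℂ _ (measurePreserving_scaleHom hb hL)).toContinuousLinearMap

theorem pull_ae (f : L2 (2 * Real.pi)) :
    pull hb hL f =ᵐ[AddCircle.haarAddCircle] f ∘ scaleHom N hb hL :=
  Lp.coeFn_compMeasurePreserving f (measurePreserving_scaleHom hb hL)

/-- The composition of a continuous function with `x ↦ x / b`. -/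
def pullC (f : C(AddCircle (2 * Real.pi), ℂ)) : C(AddCircle L, ℂ) :=
  f.comp ⟨scaleHom N hb hL, continuous_scaleHom hb hL⟩

theorem pull_toL2 (f : C(AddCircle (2 * Real.pi), ℂ)) :
    pull hb hL (toL2 f) = toL2 (pullC hb hL f) := by
  refine Lp.ext ?_
  have h := (measurePreserving_scaleHom hb hL).quasiMeasurePreserving.ae (toL2_ae f)
  filter_upwards [pull_ae hb hL (toL2 f), toL2_ae (pullC hb hL f), h] with x h1 h2 h3
  rw [h1, h2, Function.comp_apply, h3]
  rfl

theorem pull_expL (n : ℤ) : pull hb hL (expL n) = expL (N * n) := by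
  rw [← toL2_fourier, pull_toL2, ← toL2_fourier]
  congr 1
  ext x
  induction x using QuotientAddGroup.induction_on with
  | H x =>
    change fourier n (scaleHom N hb hL (x : AddCircle L)) = fourier (N * n) (x : AddCircle L)
    have hL0 : (0 : ℝ) < L := Fact.out
    have hN : (N : ℝ) ≠ 0 := fun h => by rw [hL, h, zero_mul] at hL0; exact lt_irrefl _ hL0
    rw [scaleHom_coe, fourier_coe_apply, fourier_coe_apply]
    congr 1
    have hN' : (N : ℂ) ≠ 0 := by exact_mod_cast hN
    have hb' : (b : ℂ) ≠ 0 := by exact_mod_cast hb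
    have hpi : (Real.pi : ℂ) ≠ 0 := by exact_mod_cast Real.pi_ne_zero
    have hLc : (L : ℂ) = N * (2 * Real.pi * b) := by rw [hL]; push_cast; ring
    rw [hLc]
    push_cast
    field_simp

theorem freq_mul {b : ℝ} {N : ℕ} (hb : b ≠ 0) (hL : L = N * (2 * Real.pi * b)) (n : ℤ) :
    freq L (N * n) = Complex.I * n / b := by
  have hL0 : (0 : ℝ) < L := Fact.out
  have hN : (N : ℝ) ≠ 0 := fun h => by rw [hL, h, zero_mul] at hL0; exact lt_irrefl _ hL0
  have : (2 * Real.pi * ((N * n : ℤ) : ℝ) / L : ℝ) = n / b := by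
    rw [hL]
    have := Real.pi_ne_zero
    push_cast
    field_simp
  rw [freq, this]
  push_cast
  ring

theorem isRescaling_smul_pull (a : ℝ) (f : L2 (2 * Real.pi)) :
    IsRescaling a b f ((a : ℂ) • pull hb hL f : L2 L) := by
  refine ae_line_of_ae_circle (P := fun θ => ((a : ℂ) • pull hb hL f : L2 L) θ =
    (a : ℂ) * f (scaleHom N hb hL θ)) ?_ |>.mono fun x hx => ?_
  · filter_upwards [Lp.coeFn_smul (a : ℂ) (pull hb hL f), pull_ae hb hL f] with θ h1 h2
    rw [h1, Pi.smul_apply, h2, smul_eq_mul]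
    rfl
  · rw [← scaleHom_coe hb hL]
    exact hx

/-- The pairing of the pulled back function with a test function. -/
def testL (φ : TestFun L) : L2 (2 * Real.pi) →L[ℂ] ℂ := (pairingL φ).comp (pull hb hL)

theorem testL_derivative_expL (φ : TestFun L) (n : ℤ) :
    testL hb hL φ.derivative (expL n) = -(Complex.I * n / b * testL hb hL φ (expL n)) := by
  rw [testL, testL, ContinuousLinearMap.comp_apply, ContinuousLinearMap.comp_apply, pull_expL,
    pairingL_derivative_expL, freq_mul hb hL]

theorem meanZero_expL (k : ℤ) : meanZero (expL k : L2 L) = if k = 0 then 0 else expL k := by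
  rw [meanZero, mult_expL]; split_ifs <;> simp

/-- Integration by parts through the covering, where `∂ₓ` acts as `b⁻¹` times the derivative on the
small circle; checked on exponentials. -/
theorem testL_derivative_antideriv (φ : TestFun L) (f : L2 (2 * Real.pi)) :
    testL hb hL φ.derivative (toL2 (antideriv f)) =
      -((b : ℂ)⁻¹ * testL hb hL φ (meanZero f)) := by
  have h : (testL hb hL φ.derivative).comp (toL2.comp antideriv) =
      -((b : ℂ)⁻¹ • (testL hb hL φ).comp meanZero) := by
    refine clm_ext fun k => ?_
    simp only [ContinuousLinearMap.comp_apply, neg_apply, antideriv_expL, smul_apply,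
      map_smul, toL2_fourier, testL_derivative_expL, meanZero_expL, smul_eq_mul, freq_two_pi]
    split_ifs with hk
    · simp [hk]
    · have hk' : (k : ℂ) ≠ 0 := by exact_mod_cast hk
      have hI := Complex.I_ne_zero
      field_simp
  exact congrArg (fun l => l f) h

theorem isWeakDeriv_pull (a : ℂ) (f : L2 (2 * Real.pi)) :
    IsWeakDeriv (a • pull hb hL (toL2 (antideriv f)) : L2 L)
      ((a * (b : ℂ)⁻¹) • pull hb hL (meanZero f)) := by
  intro φ
  have h := testL_derivative_antideriv hb hL φ f
  rw [pairing_smul, pairing_smul, ← pairingL_apply, ← pairingL_apply]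
  change a * testL hb hL φ.derivative (toL2 (antideriv f)) =
    -(a * (b : ℂ)⁻¹ * testL hb hL φ (meanZero f))
  rw [h]
  ring

/-- The function on the large circle whose rescaled derivative is given. -/
def liftH1 (a : ℂ) (f : L2 (2 * Real.pi)) : H1 L :=
  ⟨WithLp.toLp 2 (a • pull hb hL (toL2 (antideriv f)), (a * (b : ℂ)⁻¹) • pull hb hL (meanZero f)),
    isWeakDeriv_pull hb hL a f⟩

theorem fn_liftH1 (a : ℂ) (f : L2 (2 * Real.pi)) :
    H1.fn (liftH1 hb hL a f) = a • pull hb hL (toL2 (antideriv f)) := rfl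

theorem continuous_liftH1 (a : ℂ) : Continuous (liftH1 hb hL a) := by
  refine Continuous.subtype_mk ?_ _
  refine (WithLp.prod_continuous_toLp 2 (L2 L) (L2 L)).comp ?_
  exact ((a • (pull hb hL).comp (toL2.comp antideriv)).continuous).prodMk
    (((a * (b : ℂ)⁻¹) • (pull hb hL).comp meanZero).continuous)

end scale

/-! ### The equations in the sense of distributions -/

/-- The Fourier multiplier with symbol `(1 + n²)⁻¹`. -/
def smooth : L2 L →L[ℂ] L2 L :=
  mult (fun n => ((1 + n ^ 2 : ℝ) : ℂ)⁻¹) 1 fun n => by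
    rw [norm_inv, Complex.norm_real, Real.norm_of_nonneg (by positivity)]
    exact inv_le_one_of_one_le₀ (by nlinarith [sq_nonneg (n : ℝ)])

/-- The Fourier multiplier with symbol `i n (1 + n²)⁻¹`. -/
def smoothD : L2 L →L[ℂ] L2 L :=
  mult (fun n => Complex.I * n * ((1 + n ^ 2 : ℝ) : ℂ)⁻¹) 1 fun n => by
    have h : (n : ℂ) = ((n : ℝ) : ℂ) := by simp
    rw [h, norm_mul, norm_mul, norm_inv, Complex.norm_real, Complex.norm_real, Complex.norm_I,
      one_mul, Real.norm_of_nonneg (by positivity : (0 : ℝ) ≤ 1 + (n : ℝ) ^ 2), Real.norm_eq_abs,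
      ← div_eq_mul_inv, div_le_one (by positivity)]
    nlinarith [sq_abs (n : ℝ), sq_nonneg (|(n : ℝ)| - 1), abs_nonneg (n : ℝ)]

/-- The Fourier multiplier with symbol `n² (1 + n²)⁻¹`. -/
def smoothDD : L2 L →L[ℂ] L2 L :=
  mult (fun n => ((n ^ 2 : ℝ) : ℂ) * ((1 + n ^ 2 : ℝ) : ℂ)⁻¹) 1 fun n => by
    rw [norm_mul, norm_inv, Complex.norm_real, Complex.norm_real,
      Real.norm_of_nonneg (by positivity), Real.norm_of_nonneg (by positivity),
      ← div_eq_mul_inv, div_le_one (by positivity)]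
    linarith

theorem one_add_sq_ne_zero (n : ℤ) : ((1 + n ^ 2 : ℝ) : ℂ) ≠ 0 := by
  have : (0 : ℝ) < 1 + (n : ℝ) ^ 2 := by positivity
  exact_mod_cast this.ne'

section weak

variable {f k : ℝ → L2 L} {T : ℝ}

/-- Time derivatives of Fourier coefficients that lose two derivatives in space, tested against
functionals that gain two derivatives. -/
theorem hasDerivWithinAt_test (hk : ContinuousOn k (Icc 0 T))
    (hc : ∀ n, ∀ t ∈ Icc 0 T, HasDerivWithinAt (fun s => coef n (f s))
      (((1 + n ^ 2 : ℝ) : ℂ) * coef n (k t)) (Icc 0 T) t)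
    (l : L2 L →L[ℂ] ℂ) {t : ℝ} (ht : t ∈ Icc 0 T) :
    HasDerivWithinAt (fun s => l (smooth (f s))) (l (k t)) (Icc 0 T) t := by
  -- After division by `1 + n²` the coefficient derivatives come from a continuous curve in `L²`, so
  -- the smoothed curve is differentiable in norm.
  have h : ∀ t ∈ Icc 0 T, HasDerivWithinAt (fun s => smooth (f s)) (k t) (Icc 0 T) t := by
    refine hasDerivWithinAt_of_coef hk fun n t ht => ?_
    simp only [smooth, coef_mult]
    refine ((hc n t ht).const_mul _).congr_deriv ?_
    rw [inv_mul_cancel_left₀ (one_add_sq_ne_zero n)]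
  exact (l.restrictScalars ℝ).hasFDerivAt.comp_hasDerivWithinAt t (h t ht)

end weak

section test

variable {b : ℝ} {N : ℕ} (hb : b ≠ 0) (hL : L = N * (2 * Real.pi * b)) (φ : TestFun L)

/-- The functional which recovers `testL` after `smooth`. -/
def roughTest : L2 (2 * Real.pi) →L[ℂ] ℂ :=
  testL hb hL φ - ((b : ℂ) ^ 2) • testL hb hL φ.derivative.derivative

theorem testL_derivative_derivative_expL (n : ℤ) :
    testL hb hL φ.derivative.derivative (expL n) =
      -((n : ℂ) ^ 2 / b ^ 2 * testL hb hL φ (expL n)) := by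
  rw [testL_derivative_expL, testL_derivative_expL]
  linear_combination (n ^ 2 / b ^ 2 * testL hb hL φ (expL n) : ℂ) * Complex.I_sq

theorem roughTest_expL (n : ℤ) :
    roughTest hb hL φ (expL n) = ((1 + n ^ 2 : ℝ) : ℂ) * testL hb hL φ (expL n) := by
  have hb' : (b : ℂ) ≠ 0 := by exact_mod_cast hb
  rw [roughTest, sub_apply, smul_apply, testL_derivative_derivative_expL, smul_eq_mul]
  push_cast
  field_simp
  ring

/-- The operator `1 - b²∂ₓ²`, moved onto the smooth test function, undoes the smoothing. -/
theorem roughTest_smooth (f : L2 (2 * Real.pi)) :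
    roughTest hb hL φ (smooth f) = testL hb hL φ f := by
  have h : (roughTest hb hL φ).comp smooth = testL hb hL φ := by
    refine clm_ext fun n => ?_
    rw [ContinuousLinearMap.comp_apply, smooth, mult_expL, map_smul, roughTest_expL, smul_eq_mul,
      inv_mul_cancel_left₀ (one_add_sq_ne_zero n)]
  exact congrArg (fun l => l f) h

theorem roughTest_smoothD (f : L2 (2 * Real.pi)) :
    roughTest hb hL φ (smoothD f) = -((b : ℂ) * testL hb hL φ.derivative f) := by
  have hb' : (b : ℂ) ≠ 0 := by exact_mod_cast hb
  have h : (roughTest hb hL φ).comp smoothD = -((b : ℂ) • testL hb hL φ.derivative) := by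
    refine clm_ext fun n => ?_
    rw [ContinuousLinearMap.comp_apply, smoothD, mult_expL, map_smul, roughTest_expL, smul_eq_mul,
      neg_apply, smul_apply, testL_derivative_expL, smul_eq_mul]
    have := one_add_sq_ne_zero n
    field_simp
  exact congrArg (fun l => l f) h

theorem roughTest_smoothDD (f : L2 (2 * Real.pi)) :
    roughTest hb hL φ (smoothDD f) =
      -((b : ℂ) ^ 2 * testL hb hL φ.derivative.derivative f) := by
  have hb' : (b : ℂ) ≠ 0 := by exact_mod_cast hb
  have h : (roughTest hb hL φ).comp smoothDD =
      -((b : ℂ) ^ 2 • testL hb hL φ.derivative.derivative) := by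
    refine clm_ext fun n => ?_
    rw [ContinuousLinearMap.comp_apply, smoothDD, mult_expL, map_smul, roughTest_expL,
      smul_eq_mul, neg_apply, smul_apply, testL_derivative_derivative_expL, smul_eq_mul]
    have := one_add_sq_ne_zero n
    push_cast at this ⊢
    field_simp
  exact congrArg (fun l => l f) h

end test

namespace IsFlow

variable {p : PressureLaw} {ε δ τ : ℝ} {x : ℝ → L2 (2 * Real.pi) × L2 (2 * Real.pi)}

/-- Minus the rescaled pressure. -/
abbrev negPressure (p : PressureLaw) (ε δ : ℝ) (x : ℝ → L2 (2 * Real.pi) × L2 (2 * Real.pi))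
    (t : ℝ) : C(AddCircle (2 * Real.pi), ℂ) :=
  antideriv (eta ε x t) - (δ : ℂ) • cubic p (antideriv (eta ε x t))

theorem continuous_cubic (p : PressureLaw) : Continuous (cubic p : C(AddCircle L, ℂ) → _) := by
  cases p
  · exact continuous_star.mul (continuous_id.mul continuous_id)
  · exact continuous_star.mul (continuous_star.mul continuous_star)

theorem continuousOn_negPressure (hx : IsFlow p ε δ τ x) :
    ContinuousOn (fun t => toL2 (negPressure p ε δ x t)) (Icc 0 τ) := by
  have h : Continuous fun f : C(AddCircle (2 * Real.pi), ℂ) => toL2 (f - (δ : ℂ) • cubic p f) :=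
    toL2.continuous.comp (continuous_id.sub ((continuous_cubic p).const_smul (δ : ℂ)))
  exact (h.comp antideriv.continuous).comp_continuousOn hx.continuousOn_eta

section test

variable {N : ℕ} (hb : ε ^ 2 ≠ 0) (hL : L = N * (2 * Real.pi * ε ^ 2)) (φ : TestFun L)

theorem hasDerivWithinAt_testL_antideriv (hε : 0 < ε) (hx : IsFlow p ε δ τ x) {t : ℝ}
    (ht : t ∈ Icc 0 τ) :
    HasDerivWithinAt (fun s => testL hb hL φ (toL2 (antideriv (eta ε x s))))
      (testL hb hL φ.derivative (vel ε x t)) (Icc 0 τ) t := by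
  have hε' : (ε : ℂ) ≠ 0 := by exact_mod_cast hε.ne'
  have h := hasDerivWithinAt_test (f := fun s => toL2 (antideriv (eta ε x s)))
    (k := fun s => (-((ε : ℂ) ^ 2)⁻¹) • smoothD (vel ε x s)) (T := τ)
    ((smoothD.continuous.comp_continuousOn hx.continuousOn_vel).const_smul (-((ε : ℂ) ^ 2)⁻¹))
    (fun n t ht => by
      simp only [coef_toL2_antideriv]
      refine ((hx.hasDerivWithinAt_coef_eta hε ht n).const_mul _).congr_deriv ?_
      rw [map_smul, smoothD, coef_mult, smul_eq_mul, freq_two_pi]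
      have h1 := one_add_sq_ne_zero n
      by_cases hn : n = 0
      · simp [hn]
      have hn' : (n : ℂ) ≠ 0 := by exact_mod_cast hn
      have hI := Complex.I_ne_zero
      push_cast at h1 ⊢
      field_simp
      linear_combination (coef n (vel ε x t)) * Complex.I_sq)
    (roughTest hb hL φ) ht
  simp only [roughTest_smooth] at h
  refine h.congr_deriv ?_
  rw [map_smul, roughTest_smoothD, smul_eq_mul]
  push_cast
  field_simp

theorem hasDerivWithinAt_testL_vel (hε : 0 < ε) (hx : IsFlow p ε δ τ x) {t : ℝ}
    (ht : t ∈ Icc 0 τ) :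
    HasDerivWithinAt (fun s => testL hb hL φ (vel ε x s))
      (-testL hb hL φ.derivative (toL2 (negPressure p ε δ x t)) -
        Complex.I * ε * testL hb hL φ.derivative.derivative (vel ε x t)) (Icc 0 τ) t := by
  have hε' : (ε : ℂ) ≠ 0 := by exact_mod_cast hε.ne'
  have h := hasDerivWithinAt_test (f := vel ε x)
    -- The right-hand side of the rescaled equation for `v₂` divided by `1 + n²`: the Schrödinger
    -- term through `smoothDD`, the pressure term through `smoothD`.
    (k := fun s => (Complex.I * ((ε : ℂ) ^ 3)⁻¹) • smoothDD (vel ε x s) +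
      ((ε : ℂ) ^ 2)⁻¹ • smoothD (toL2 (negPressure p ε δ x s))) (T := τ)
    (((smoothDD.continuous.comp_continuousOn hx.continuousOn_vel).const_smul
      (Complex.I * ((ε : ℂ) ^ 3)⁻¹)).add
      ((smoothD.continuous.comp_continuousOn hx.continuousOn_negPressure).const_smul
      ((ε : ℂ) ^ 2)⁻¹))
    (fun n t ht => by
      refine (hx.hasDerivWithinAt_coef_vel ht n).congr_deriv ?_
      rw [der_force p δ (eta ε x t) n, map_add, map_smul, map_smul, smoothD, smoothDD, coef_mult,
        coef_mult, smul_eq_mul, smul_eq_mul, freq_two_pi]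
      have h1 := one_add_sq_ne_zero n
      push_cast at h1 ⊢
      field_simp)
    (roughTest hb hL φ) ht
  simp only [roughTest_smooth] at h
  refine h.congr_deriv ?_
  rw [map_add, map_smul, map_smul, roughTest_smoothD, roughTest_smoothDD, smul_eq_mul, smul_eq_mul]
  push_cast
  field_simp
  ring

/-- The solution on the large circle which corresponds to a flow. -/
def toSolution (a : ℝ) (x : ℝ → L2 (2 * Real.pi) × L2 (2 * Real.pi)) (t : ℝ) : H1 L × L2 L :=
  (liftH1 hb hL a (eta ε x t), (a : ℂ) • pull hb hL (vel ε x t))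

theorem cubic_smul (p : PressureLaw) (a : ℝ) (f : C(AddCircle L, ℂ)) :
    cubic p ((a : ℂ) • f) = ((a : ℂ) ^ 3) • cubic p f := by
  cases p
  all_goals
    ext x
    simp [cubic, twistC]
    ring

theorem pullC_cubic (p : PressureLaw) (f : C(AddCircle (2 * Real.pi), ℂ)) :
    cubic p (pullC hb hL f) = pullC hb hL (cubic p f) := by
  cases p <;> rfl

/-- The cubic part is homogeneous of degree three, so the pressure of `a v` is `a (-v + a² c(v))`;
this fixes `δ = a²`. -/
theorem pairing_pressure {a : ℝ} (ha : a ^ 2 = δ) (f : L2 (2 * Real.pi)) :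
    pairing (fun θ => p.pressure (H1.fn (liftH1 hb hL a f) θ)) φ =
      -((a : ℂ) * testL hb hL φ (toL2 (antideriv f - (δ : ℂ) • cubic p (antideriv f)))) := by
  have h : (a : ℂ) * testL hb hL φ (toL2 (antideriv f - (δ : ℂ) • cubic p (antideriv f))) =
      pairing ((a : ℂ) • toL2 (pullC hb hL (antideriv f - (δ : ℂ) • cubic p (antideriv f))) : L2 L)
        φ := by
    rw [pairing_smul, ← pull_toL2, ← pairingL_apply]
    rfl
  rw [h, pairing, pairing, ← integral_neg]
  refine integral_congr_ae ?_
  rw [fn_liftH1, pull_toL2]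
  filter_upwards [Lp.coeFn_smul (a : ℂ) (toL2 (pullC hb hL (antideriv f))),
    toL2_ae (pullC hb hL (antideriv f)), Lp.coeFn_smul (a : ℂ)
      (toL2 (pullC hb hL (antideriv f - (δ : ℂ) • cubic p (antideriv f)))),
    toL2_ae (pullC hb hL (antideriv f - (δ : ℂ) • cubic p (antideriv f)))] with θ h1 h2 h3 h4
  rw [h1, h3, Pi.smul_apply, Pi.smul_apply, h2, h4]
  have h5 := pressure_eq p ((a : ℂ) • pullC hb hL (antideriv f)) θ
  rw [cubic_smul, pullC_cubic] at h5
  rw [ContinuousMap.smul_apply, ContinuousMap.smul_apply] at h5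
  rw [h5, ← ha]
  simp only [pullC, ContinuousMap.comp_apply, ContinuousMap.sub_apply, ContinuousMap.smul_apply,
    smul_eq_mul]
  push_cast
  ring

theorem isSolution (hε : 0 < ε) {a : ℝ} (ha : a ^ 2 = δ) (hx : IsFlow p ε δ τ x) :
    IsSolution p ε τ (toSolution hb hL a x) where
  continuousOn := ((continuous_liftH1 hb hL a).comp_continuousOn hx.continuousOn_eta).prodMk
    (((pull hb hL).continuous.comp_continuousOn hx.continuousOn_vel).const_smul (a : ℂ))
  first φ t ht := by
    have h := (hx.hasDerivWithinAt_testL_antideriv hb hL φ hε ht).const_mul (a : ℂ)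
    simp only [toSolution, fn_liftH1, ← pairingL_apply, map_smul, smul_eq_mul]
    exact h
  second φ t ht := by
    have h := (hx.hasDerivWithinAt_testL_vel hb hL φ hε ht).const_mul (a : ℂ)
    simp only [toSolution, pairing_pressure hb hL _ ha, ← pairingL_apply, map_smul, smul_eq_mul]
    refine h.congr_deriv ?_
    simp only [testL, ContinuousLinearMap.comp_apply]
    ring

end test

end IsFlow

/-! ### Continuous representatives and the pressure of an `H¹` function -/

theorem H1.ext_fn {v w : H1 L} (h : H1.fn v = H1.fn w) : v = w := by
  have hd : v.1.snd = w.1.snd := coef_ext fun n => by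
    rw [IsWeakDeriv.coef_eq v.2 n, IsWeakDeriv.coef_eq w.2 n]
    exact congrArg (fun f => freq L n * coef n f) h
  refine Subtype.ext ((WithLp.equiv 2 (L2 L × L2 L)).injective (Prod.ext h hd))

theorem continuous_fn : Continuous (H1.fn : H1 L → L2 L) :=
  (continuous_fst.comp (WithLp.prod_continuous_ofLp 2 (L2 L) (L2 L))).comp continuous_subtype_val

theorem continuous_deriv : Continuous fun w : H1 L => w.1.snd :=
  (continuous_snd.comp (WithLp.prod_continuous_ofLp 2 (L2 L) (L2 L))).comp continuous_subtype_val

/-- The continuous representative of an element of `H¹`. -/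
def contRep (w : H1 L) : C(AddCircle L, ℂ) :=
  coef 0 (H1.fn w) • (1 : C(AddCircle L, ℂ)) + antideriv w.1.snd

theorem continuous_contRep : Continuous (contRep : H1 L → C(AddCircle L, ℂ)) := by
  have h1 := (coef 0).continuous.comp (continuous_fn (L := L))
  have h2 := antideriv.continuous.comp (continuous_deriv (L := L))
  exact (h1.smul continuous_const).add h2

theorem toL2_contRep (w : H1 L) : toL2 (contRep w) = H1.fn w := by
  refine coef_ext fun n => ?_
  have h1 : toL2 (1 : C(AddCircle L, ℂ)) = expL 0 := by
    rw [← toL2_fourier]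
    congr 1
    ext x
    simp
  rw [contRep, map_add, map_add, map_smul, map_smul, h1, coef_expL, coef_toL2_antideriv,
    IsWeakDeriv.coef_eq w.2 n, smul_eq_mul]
  by_cases hn : n = 0
  · simp [hn, freq_zero]
  · rw [inv_mul_cancel_left₀ (freq_ne_zero hn), if_neg hn, mul_zero, zero_add]
    rfl

/-- The pressure, as a function of the continuous representative. -/
def pressC (p : PressureLaw) (f : C(AddCircle L, ℂ)) : C(AddCircle L, ℂ) := -f + cubic p f

theorem fourierCoeff_pressure (p : PressureLaw) (w : H1 L) (n : ℤ) :
    fourierCoeff (fun x => p.pressure (H1.fn w x)) n = coef n (toL2 (pressC p (contRep w))) := by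
  rw [coef_eq_fourierCoeff]
  refine congrFun (fourierCoeff_congr_ae (E := ℂ) ?_) n
  have h := toL2_ae (contRep w)
  rw [toL2_contRep] at h
  filter_upwards [h, toL2_ae (pressC p (contRep w))] with x h1 h2
  rw [h1, h2, pressure_eq]
  rfl

/-- Sup bounds on `f` and `g` suffice for an `L²` Lipschitz bound, so uniqueness needs no derivative
of the difference of the first components. -/
theorem norm_pressC_sub_le (p : PressureLaw) {f g : C(AddCircle L, ℂ)} {M : ℝ}
    (hf : ‖f‖ ≤ M) (hg : ‖g‖ ≤ M) :
    ‖toL2 (pressC p f - pressC p g)‖ ≤ (1 + 3 * M ^ 2) * ‖toL2 (f - g)‖ := by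
  refine Lp.norm_le_mul_norm_of_ae_le_mul ?_
  filter_upwards [toL2_ae (pressC p f - pressC p g), toL2_ae (f - g)] with x h1 h2
  rw [h1, h2]
  have hM : 0 ≤ M := (norm_nonneg _).trans hf
  have hfx := (f.norm_coe_le_norm x).trans hf
  have hgx := (g.norm_coe_le_norm x).trans hg
  set z := f x with hz
  set w := g x with hw
  have key : ∀ a b c a' b' c' : ℂ, ‖a - a'‖ = ‖z - w‖ → ‖b - b'‖ = ‖z - w‖ → ‖c - c'‖ = ‖z - w‖ →
      ‖b‖ ≤ M → ‖c‖ ≤ M → ‖a'‖ ≤ M → ‖b'‖ ≤ M →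
      ‖a * (b * c) - a' * (b' * c')‖ ≤ 3 * M ^ 2 * ‖z - w‖ := by
    intro a b c a' b' c' h1 h2 h3 hb hc ha' hb'
    have e : a * (b * c) - a' * (b' * c') =
      (a - a') * b * c + a' * (b - b') * c + a' * b' * (c - c') := by ring
    rw [e]
    refine norm_add₃_le.trans ?_
    simp only [norm_mul, h1, h2, h3]
    have e1 : ‖z - w‖ * ‖b‖ * ‖c‖ ≤ ‖z - w‖ * M * M := by gcongr
    have e2 : ‖a'‖ * ‖z - w‖ * ‖c‖ ≤ M * ‖z - w‖ * M := by gcongr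
    have e3 : ‖a'‖ * ‖b'‖ * ‖z - w‖ ≤ M * M * ‖z - w‖ := by gcongr
    linarith
  have hc : ‖starRingEnd ℂ z - starRingEnd ℂ w‖ = ‖z - w‖ := by
    rw [← map_sub, Complex.norm_conj]
  have hzc : ‖starRingEnd ℂ z‖ ≤ M := by rwa [Complex.norm_conj]
  have hwc : ‖starRingEnd ℂ w‖ ≤ M := by rwa [Complex.norm_conj]
  have hcub : ‖cubic p f x - cubic p g x‖ ≤ 3 * M ^ 2 * ‖z - w‖ := by
    cases p
    · exact key _ _ _ _ _ _ hc rfl rfl hfx hfx hwc hgx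
    · exact key _ _ _ _ _ _ hc hc hc hzc hzc hwc hwc
  have e : (pressC p f - pressC p g) x = -(z - w) + (cubic p f x - cubic p g x) := by
    simp only [pressC, ContinuousMap.sub_apply, ContinuousMap.add_apply, ContinuousMap.neg_apply,
      hz, hw]
    ring
  rw [e, ContinuousMap.sub_apply, add_mul, one_mul]
  refine (norm_add_le _ _).trans (add_le_add ?_ hcub)
  rw [norm_neg]

/-! ### Uniqueness -/

namespace IsSolution

variable {p : PressureLaw} {ε T : ℝ} {u v : ℝ → H1 L × L2 L}

theorem hasDerivWithinAt_coef_fst (hu : IsSolution p ε T u) {t : ℝ} (ht : t ∈ Icc 0 T) (n : ℤ) :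
    HasDerivWithinAt (fun s => coef n (H1.fn (u s).1)) (-(freq L n * coef n (u t).2))
      (Icc 0 T) t := by
  have h := hu.first (expTest L (-n)) t ht
  simp only [pairing_expTest, pairing_expTest_derivative, neg_neg, ← coef_eq_fourierCoeff,
    freq_neg] at h
  rwa [neg_mul] at h

theorem hasDerivWithinAt_coef_snd (hu : IsSolution p ε T u) {t : ℝ} (ht : t ∈ Icc 0 T) (n : ℤ) :
    HasDerivWithinAt (fun s => coef n (u s).2)
      (-(freq L n * coef n (toL2 (pressC p (contRep (u t).1))))
        - Complex.I * ε * freq L n ^ 2 * coef n (u t).2) (Icc 0 T) t := by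
  have h := hu.second (expTest L (-n)) t ht
  simp only [pairing_expTest, pairing_expTest_derivative, pairing_expTest_derivative_derivative,
    neg_neg, fourierCoeff_pressure, freq_neg, ← coef_eq_fourierCoeff] at h
  refine h.congr_deriv ?_
  ring

theorem freq_sq (ε : ℝ) (n : ℤ) :
    Complex.I * ((ε * (2 * Real.pi / L) ^ 2 * n ^ 2 : ℝ) : ℂ) =
      -(Complex.I * ε * freq L n ^ 2) := by
  rw [freq, mul_pow, Complex.I_sq]
  push_cast
  ring

theorem eqOn (hε : 0 < ε) (hu : IsSolution p ε T u) (hv : IsSolution p ε T v)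
    (h1 : H1.fn (v 0).1 = H1.fn (u 0).1) (h2 : (v 0).2 = (u 0).2) : EqOn v u (Icc 0 T) := by
  intro t₀ ht₀
  have hT : 0 ≤ T := ht₀.1.trans ht₀.2
  have h0T : (0 : ℝ) ∈ Icc 0 T := left_mem_Icc.2 hT
  have hε' : (ε : ℂ) ≠ 0 := by exact_mod_cast hε.ne'
  set μ : ℝ := ε * (2 * Real.pi / L) ^ 2 with hμ
  set d₁ : ℝ → L2 L := fun t => H1.fn (v t).1 - H1.fn (u t).1 with hd₁
  set d₂ : ℝ → L2 L := fun t => (v t).2 - (u t).2 with hd₂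
  set Δ : ℝ → L2 L := fun t =>
    toL2 (pressC p (contRep (v t).1) - pressC p (contRep (u t).1)) with hΔ
  set ζ : ℝ → L2 L := fun t => toL2 (antideriv (d₂ t)) with hζ
  -- The analogue of `ω` one derivative lower: in `W` the term `-∂ₓd₂` cancels against the
  -- Schrödinger term of `(i/ε)ζ`, leaving the pressure difference without derivative. Likewise `y`
  -- is `ζ` with its Schrödinger evolution removed.
  set W : ℝ → L2 L := fun t => d₁ t + (Complex.I / ε) • ζ t with hW
  set y : ℝ → L2 L := fun t => group μ (-t) (ζ t) with hy
  have hru := continuous_contRep.comp_continuousOn (continuous_fst.comp_continuousOn hu.continuousOn)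
  have hrv := continuous_contRep.comp_continuousOn (continuous_fst.comp_continuousOn hv.continuousOn)
  have hpc : Continuous (pressC p : C(AddCircle L, ℂ) → _) :=
    continuous_neg.add (IsFlow.continuous_cubic p)
  have hΔc : ContinuousOn Δ (Icc 0 T) :=
    toL2.continuous.comp_continuousOn
      ((hpc.comp_continuousOn hrv).sub (hpc.comp_continuousOn hru))
  have c₁ : ∀ n, ∀ t ∈ Icc 0 T,
      HasDerivWithinAt (fun s => coef n (d₁ s)) (-(freq L n * coef n (d₂ t))) (Icc 0 T) t := by
    intro n t ht
    have h := (hv.hasDerivWithinAt_coef_fst ht n).fun_sub (hu.hasDerivWithinAt_coef_fst ht n)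
    simp only [hd₁, hd₂, map_sub]
    refine h.congr_deriv ?_
    ring
  have c₂ : ∀ n, ∀ t ∈ Icc 0 T, HasDerivWithinAt (fun s => coef n (d₂ s))
      (-(freq L n * coef n (Δ t)) - Complex.I * ε * freq L n ^ 2 * coef n (d₂ t)) (Icc 0 T) t := by
    intro n t ht
    have h := (hv.hasDerivWithinAt_coef_snd ht n).fun_sub (hu.hasDerivWithinAt_coef_snd ht n)
    simp only [hd₂, hΔ, map_sub]
    refine h.congr_deriv ?_
    ring
  have cζ : ∀ n, ∀ t ∈ Icc 0 T, HasDerivWithinAt (fun s => coef n (ζ s))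
      (-coef n (meanZero (Δ t)) - Complex.I * ε * freq L n * coef n (d₂ t)) (Icc 0 T) t := by
    intro n t ht
    simp only [hζ, coef_toL2_antideriv]
    refine ((c₂ n t ht).const_mul _).congr_deriv ?_
    rw [coef_meanZero]
    by_cases hn : n = 0
    · simp [hn, freq_zero]
    · have := freq_ne_zero (L := L) hn
      rw [if_neg hn]
      field_simp
  have dW : ∀ t ∈ Icc 0 T,
      HasDerivWithinAt W (-((Complex.I / ε) • meanZero (Δ t))) (Icc 0 T) t := by
    have hk : ContinuousOn (fun t => -((Complex.I / ε : ℂ) • meanZero (Δ t))) (Icc 0 T) :=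
      ((meanZero.continuous.comp_continuousOn hΔc).const_smul (Complex.I / ε : ℂ)).neg
    refine hasDerivWithinAt_of_coef hk fun n t ht => ?_
    simp only [hW, map_add, map_smul, smul_eq_mul, map_neg]
    refine ((c₁ n t ht).fun_add ((cζ n t ht).const_mul (Complex.I / ε))).congr_deriv ?_
    field_simp
    linear_combination (-(ε : ℂ) * freq L n * coef n (d₂ t)) * Complex.I_sq
  have dy : ∀ t ∈ Icc 0 T,
      HasDerivWithinAt y (-group μ (-t) (meanZero (Δ t))) (Icc 0 T) t := by
    have hk : ContinuousOn (fun t => -group μ (-t) (meanZero (Δ t))) (Icc 0 T) :=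
      (continuousOn_group_comp μ continuousOn_neg
        (meanZero.continuous.comp_continuousOn hΔc)).neg
    refine hasDerivWithinAt_of_coef hk fun n t ht => ?_
    have he : ∀ s : ℝ, μ * n ^ 2 * -s = -(μ * n ^ 2) * s := fun s => by ring
    simp only [hy, map_neg, coef_group, he]
    refine (((hasDerivAt_exp_I_mul (-(μ * n ^ 2)) t).hasDerivWithinAt (s := Icc 0 T)).fun_mul
      (cζ n t ht)).congr_deriv ?_
    have hf : Complex.I * ((-(μ * n ^ 2) : ℝ) : ℂ) = Complex.I * ε * freq L n ^ 2 := by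
      have := freq_sq (L := L) ε n
      rw [← hμ] at this
      rw [Complex.ofReal_neg, mul_neg, this, neg_neg]
    have hfz : freq L n ^ 2 * coef n (ζ t) = freq L n * coef n (d₂ t) := by
      simp only [hζ, coef_toL2_antideriv]
      by_cases hn : n = 0
      · simp [hn, freq_zero]
      · have := freq_ne_zero (L := L) hn
        field_simp
    generalize Complex.exp (Complex.I * ((-(μ * n ^ 2) * t : ℝ) : ℂ)) = E
    rw [hf]
    linear_combination Complex.I * ε * E * hfz
  obtain ⟨M₁, hM₁⟩ := isCompact_Icc.exists_bound_of_continuousOn hru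
  obtain ⟨M₂, hM₂⟩ := isCompact_Icc.exists_bound_of_continuousOn hrv
  -- Both solutions are continuous in `H¹` on a compact interval, hence uniformly bounded in the sup
  -- norm.
  set K : ℝ := 1 + 3 * (max M₁ M₂) ^ 2 with hK
  have hΔb : ∀ t ∈ Icc 0 T, ‖Δ t‖ ≤ K * ‖d₁ t‖ := by
    intro t ht
    have h := norm_pressC_sub_le p ((hM₂ t ht).trans (le_max_right M₁ M₂))
      ((hM₁ t ht).trans (le_max_left M₁ M₂))
    have e : d₁ t = toL2 (contRep (v t).1 - contRep (u t).1) := by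
      rw [map_sub, toL2_contRep, toL2_contRep]
    rw [e]
    exact h
  set Y : ℝ → L2 L × L2 L := fun t => (W t, y t) with hY
  have hd₁b : ∀ t, ‖d₁ t‖ ≤ (1 + 1 / ε) * ‖Y t‖ := by
    intro t
    have e : d₁ t = W t - (Complex.I / ε) • group μ t (y t) := by
      rw [hy, group_group_neg, hW, add_sub_cancel_right]
    have b1 : ‖W t‖ ≤ ‖Y t‖ := norm_fst_le (Y t)
    have b2 : ‖y t‖ ≤ ‖Y t‖ := norm_snd_le (Y t)
    rw [e]
    refine (norm_sub_le _ _).trans ?_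
    rw [norm_smul, norm_group, norm_div, Complex.norm_I, Complex.norm_real,
      Real.norm_of_nonneg hε.le, add_mul, one_mul]
    gcongr
  have hYd : ∀ t ∈ Icc 0 T, HasDerivWithinAt Y
      (-((Complex.I / ε) • meanZero (Δ t)), -group μ (-t) (meanZero (Δ t))) (Icc 0 T) t :=
    fun t ht => (dW t ht).prodMk (dy t ht)
  have hd10 : d₁ 0 = 0 := by simp only [hd₁, h1, sub_self]
  have hd20 : d₂ 0 = 0 := by simp only [hd₂, h2, sub_self]
  have hζ0 : ζ 0 = 0 := by simp only [hζ, hd20, map_zero]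
  have hYz : ∀ t ∈ Icc 0 T, Y t = 0 := by
    refine eq_zero_of_abs_deriv_le_mul_abs_self_of_eq_zero_right
      (K := (1 + 1 / ε) * (K * (1 + 1 / ε)))
      (fun t ht => (hYd t ht).continuousWithinAt)
      (fun t ht => (hYd t (Ico_subset_Icc_self ht)).mono_of_mem_nhdsWithin
        (Icc_mem_nhdsGE_of_mem ht)) ?_ fun t ht => ?_
    · simp only [hY, hW, hy, hd10, hζ0, map_zero, smul_zero, add_zero]
      rfl
    · have b := hΔb t (Ico_subset_Icc_self ht)
      have b1 := norm_meanZero_le (Δ t)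
      have hK0 : 0 ≤ K := by positivity
      have b2 : ‖meanZero (Δ t)‖ ≤ K * ((1 + 1 / ε) * ‖Y t‖) :=
        b1.trans (b.trans (mul_le_mul_of_nonneg_left (hd₁b t) hK0))
      have b3 : ‖(-((Complex.I / ε) • meanZero (Δ t)), -group μ (-t) (meanZero (Δ t)))‖ ≤
          (1 + 1 / ε) * ‖meanZero (Δ t)‖ := by
        rw [Prod.norm_def, norm_neg, norm_neg, norm_smul, norm_group, norm_div, Complex.norm_I,
          Complex.norm_real, Real.norm_of_nonneg hε.le, add_mul, one_mul]
        have : 0 ≤ 1 / ε * ‖meanZero (Δ t)‖ := by positivity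
        have := norm_nonneg (meanZero (Δ t))
        exact max_le (by linarith) (by linarith)
      calc _ ≤ (1 + 1 / ε) * ‖meanZero (Δ t)‖ := b3
        _ ≤ (1 + 1 / ε) * (K * ((1 + 1 / ε) * ‖Y t‖)) := by gcongr
        _ = _ := by ring
  have hd1z : d₁ t₀ = 0 := by
    have := hd₁b t₀
    rwa [hYz t₀ ht₀, norm_zero, mul_zero, norm_le_zero_iff] at this
  have hζz : ζ t₀ = 0 := by
    have : y t₀ = 0 := congrArg Prod.snd (hYz t₀ ht₀)
    have h := norm_group μ (-t₀) (ζ t₀)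
    rw [hy] at this
    simp only at this
    rw [this, norm_zero] at h
    exact norm_eq_zero.1 h.symm
  have hd2z : d₂ t₀ = 0 := by
    refine coef_ext fun n => ?_
    -- The antiderivative does not see the zero mode of `d₂`; that mode is constant in time because
    -- every term of its equation carries a factor `freq L 0`.
    by_cases hn : n = 0
    · have := Convex.norm_image_sub_le_of_norm_hasDerivWithin_le (C := 0) (c₂ n)
        (fun t _ => by simp [hn, freq_zero]) (convex_Icc 0 T) h0T ht₀
      simpa [hd20] using this
    · have h := congrArg (coef n) hζz
      simp only [hζ, coef_toL2_antideriv, map_zero] at h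
      rw [map_zero]
      exact (mul_eq_zero.1 h).resolve_left (inv_ne_zero (freq_ne_zero hn))
  exact Prod.ext (H1.ext_fn (sub_eq_zero.1 hd1z)) (sub_eq_zero.1 hd2z)

end IsSolution

end VdW

end

/-! ### Existence and uniqueness in the original variables -/

theorem theorem2 :
    ∃ T : ℝ, 0 < T ∧ ∃ ε₀ : ℝ, 0 < ε₀ ∧
      ∀ (p : VdW.PressureLaw) (ε : ℝ), 0 < ε → ε < ε₀ →
      ∀ (u₁ : VdW.H1 (2 * Real.pi)) (u₂ : VdW.L2 (2 * Real.pi)),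
        ∫ x, VdW.H1.fn u₁ x ∂AddCircle.haarAddCircle = 0 →
        ∫ x, u₂ x ∂AddCircle.haarAddCircle = 0 →
        max ‖u₁‖ ‖u₂‖ < 1 / 6 →
        VdW.energy p (VdW.H1.fn u₁) u₂ ≤ 0 →
      ∀ (L : ℝ) [Fact (0 < L)] (N : ℕ), L = N * (2 * Real.pi * ε ^ 2) →
        ∃ u : ℝ → VdW.H1 L × VdW.L2 L,
          (VdW.IsSolution p ε T u ∧
            VdW.IsRescaling (ε ^ p.exponent) (ε ^ 2) (VdW.H1.fn u₁) (VdW.H1.fn (u 0).1) ∧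
            VdW.IsRescaling (ε ^ p.exponent) (ε ^ 2) u₂ (u 0).2) ∧
          ∀ v : ℝ → VdW.H1 L × VdW.L2 L,
            VdW.IsSolution p ε T v →
            VdW.IsRescaling (ε ^ p.exponent) (ε ^ 2) (VdW.H1.fn u₁) (VdW.H1.fn (v 0).1) →
            VdW.IsRescaling (ε ^ p.exponent) (ε ^ 2) u₂ (v 0).2 →
            Set.EqOn v u (Set.Icc 0 T) := by
  open VdW in
  obtain ⟨T, hT, ε₁, hε₁, H⟩ := exists_flow
  refine ⟨T, hT, min ε₁ 1, lt_min hε₁ one_pos, ?_⟩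
  intro p ε hε hε₀ u₁ u₂ hm₁ _ hsmall _ L _ N hL
  have hb : ε ^ 2 ≠ 0 := (pow_pos hε 2).ne'
  have hεlt : ε < 1 := hε₀.trans_le (min_le_right _ _)
  have hc0 : coef 0 (H1.fn u₁) = 0 := by
    rw [coef_eq_fourierCoeff, fourierCoeff, ← hm₁]
    simp
  have hcd : coef 0 u₁.1.snd = 0 := by
    rw [IsWeakDeriv.coef_eq u₁.2 0, freq_zero, zero_mul]
  have hn₁ : ‖u₁.1.snd‖ ≤ 1 / 6 := by
    refine le_trans ?_ ((le_max_left _ _).trans hsmall.le)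
    have h : ‖u₁‖ ^ 2 = ‖u₁.1.fst‖ ^ 2 + ‖u₁.1.snd‖ ^ 2 := WithLp.prod_norm_sq_eq_of_L2 u₁.1
    refine le_of_sq_le_sq ?_ (norm_nonneg _)
    nlinarith [sq_nonneg ‖u₁.1.fst‖]
  have hn₂ : ‖u₂‖ ≤ 1 / 6 := (le_max_right _ _).trans hsmall.le
  -- Only the mean-zero part of `u₂` enters `ω`, which keeps the mean of `ω` zero. The recovered
  -- `∂ₓv₁` then has zero mode `-iε` times the mean of `u₂`, which `antideriv` discards. Since `ε <
  -- 1`, `‖ω‖ ≤ 1/6 + 1/6`.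
  set x₀ : L2 (2 * Real.pi) × L2 (2 * Real.pi) :=
    (u₁.1.snd + (Complex.I * ε) • meanZero u₂, u₂) with hx₀
  have hx00 : coef 0 x₀.1 = 0 := by
    rw [hx₀, map_add, map_smul, hcd, coef_meanZero, if_pos rfl, smul_zero, add_zero]
  have hx01 : ‖x₀.1‖ ≤ 1 / 3 := by
    refine (norm_add_le _ _).trans ?_
    rw [norm_smul, norm_mul, Complex.norm_I, one_mul, Complex.norm_real,
      Real.norm_of_nonneg hε.le]
    have := norm_meanZero_le u₂
    nlinarith [norm_nonneg (meanZero u₂)]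
  obtain ⟨x, hx0, hx⟩ := H p ε hε (hε₀.trans_le (min_le_left _ _)) x₀ hx00 hx01 (by
    change ‖u₂‖ ≤ 1
    linarith)
  have hsol := IsFlow.isSolution hb hL hε (coupling_eq_sq p hε).symm hx
  have hvel : IsFlow.vel ε x 0 = u₂ := by
    rw [IsFlow.vel, group_zero, hx0]
  have hfn : toL2 (antideriv (IsFlow.eta ε x 0)) = H1.fn u₁ := by
    refine coef_ext fun n => ?_
    rw [coef_toL2_antideriv, IsFlow.eta, etaOf, group_zero, hx0, hx₀]
    by_cases hn : n = 0
    · rw [hn, freq_zero, inv_zero, zero_mul, hc0]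
    · rw [map_sub, map_add, map_smul, map_smul, coef_meanZero, if_neg hn, add_sub_cancel_right,
        IsWeakDeriv.coef_eq u₁.2 n, inv_mul_cancel_left₀ (freq_ne_zero hn)]
      rfl
  have r₁ : IsRescaling (ε ^ p.exponent) (ε ^ 2) (H1.fn u₁)
      (H1.fn (IsFlow.toSolution hb hL (ε ^ p.exponent) x 0).1) := by
    rw [← hfn]
    exact isRescaling_smul_pull hb hL _ _
  have r₂ : IsRescaling (ε ^ p.exponent) (ε ^ 2) u₂
      (IsFlow.toSolution hb hL (ε ^ p.exponent) x 0).2 := by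
    have h := isRescaling_smul_pull hb hL (ε ^ p.exponent) (IsFlow.vel ε x 0)
    rw [hvel] at h
    rw [IsFlow.toSolution, hvel]
    exact h
  exact ⟨_, ⟨hsol, r₁, r₂⟩, fun v hv s₁ s₂ => hsol.eqOn hε hv (s₁.unique r₁) (s₂.unique r₂)⟩
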